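/- Let $K$ be a field and let $\mathsf{Hopf}_{K,coc}$ be the category of cocommutative Hopf $K$-algebras, whose morphisms are the linear maps that are both algebra and coalgebra morphisms. Let $p\colon A\to B$ be a surjective morphism in $\mathsf{Hopf}_{K,coc}$ and let $C\subseteq B$ be a Hopf subalgebra (a subalgebra with $\Delta(C)\subseteq C\otimes C$ and $S(C)\subseteq C$), with inclusion $i\colon C\to B$. Put $C^+=\{c\in C\mid \epsilon(c)=0\}$ and let $$p^{-1}(C)=\{x\in A\mid (p\otimes \mathrm{id}_A)\Delta(x)-1\otimes x\in C^+\otimes A\}$$ be the h-inverse of $C$ along $p$; it is a Hopf subalgebra of $A$, with inclusion $j\colon p^{-1}(C)\to A$, and $p$ maps it into $C$. Let $\hat p\colon p^{-1}(C)\to C$ be the restriction of $p$. Then the square $i\circ\hat p=p\circ j$ is a pullback in $\mathsf{Hopf}_{K,coc}$, and $\hat p$ is surjective. Consequently, for every pullback square in $\mathsf{Hopf}_{K,coc}$ of $p$ along $i$, with projections $q\colon P\to C$ and $P\to A$, the morphism $q$ is surjective. -/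

import Mathlib

open scoped TensorProduct

universe u v

/-- A bialgebra morphism between Hopf algebras commutes with the antipodes. -/
theorem BialgHom.apply_antipode {K A B : Type*} [CommRing K] [Ring A] [Ring B]
    [HopfAlgebra K A] [HopfAlgebra K B] (f : A →ₐc[K] B) (a : A) :
    f (HopfAlgebra.antipode K a) = HopfAlgebra.antipode K (f a) := by
  have h : WithConv.toConv ((AlgHomClass.toAlgHom f).toLinearMap ∘ₗ HopfAlgebra.antipode K)
      = WithConv.toConv (HopfAlgebra.antipode K ∘ₗ f.toCoalgHom.toLinearMap) := by
    apply left_inv_eq_right_inv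
      (a := WithConv.toConv ((AlgHomClass.toAlgHom f).toLinearMap ∘ₗ LinearMap.id))
    · apply WithConv.ofConv_injective
      have := LinearMap.algHom_comp_convMul_distrib (R := K) (AlgHomClass.toAlgHom f)
        (WithConv.toConv (HopfAlgebra.antipode K (A := A))) (WithConv.toConv LinearMap.id)
      rw [LinearMap.antipode_mul_id, LinearMap.algHom_comp_convOne] at this
      exact this.symm
    · apply WithConv.ofConv_injective
      have := LinearMap.convMul_comp_coalgHom_distrib (R := K)
        (WithConv.toConv LinearMap.id) (WithConv.toConv (HopfAlgebra.antipode K (A := B)))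
        f.toCoalgHom
      rw [LinearMap.id_mul_antipode, LinearMap.convOne_comp_coalgHom] at this
      exact this.symm
  exact LinearMap.congr_fun (WithConv.toConv_injective h) a

/-- In a cocommutative Hopf algebra the antipode is a coalgebra morphism. -/
theorem HopfAlgebra.comul_antipode_of_isCocomm {K A : Type*} [CommRing K] [Ring A]
    [HopfAlgebra K A] [Coalgebra.IsCocomm K A] (a : A) :
    Coalgebra.comul (R := K) (HopfAlgebra.antipode K a)
      = TensorProduct.map (HopfAlgebra.antipode K) (HopfAlgebra.antipode K)
          (Coalgebra.comul (R := K) a) :=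
  BialgHom.apply_antipode (Bialgebra.comulBialgHom K A) a

/-- A Hopf subalgebra `C` of a Hopf algebra `A`: a subalgebra with `Δ(C) ⊆ C ⊗ C` (the image of
`C ⊗ C` in `A ⊗ A`) and `S(C) ⊆ C`. -/
structure HopfSubalgebra (K : Type u) (A : Type v) [Field K] [Ring A] [HopfAlgebra K A]
    extends Subalgebra K A where
  comul_mem' : ∀ x ∈ carrier, Coalgebra.comul (R := K) x ∈
    LinearMap.range (TensorProduct.map toSubalgebra.val.toLinearMap toSubalgebra.val.toLinearMap)
  antipode_mem' : ∀ x ∈ carrier, HopfAlgebra.antipode K x ∈ carrier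

namespace HopfSubalgebra

section Structure

variable {K : Type u} {A : Type v} [Field K] [Ring A] [HopfAlgebra K A]

instance : CoeSort (HopfSubalgebra K A) (Type v) := ⟨fun C => C.toSubalgebra⟩

variable (C : HopfSubalgebra K A)

/-- The inclusion `C → A` as a linear map. -/
abbrev incl : C →ₗ[K] A := C.toSubalgebra.val.toLinearMap

theorem incl_injective : Function.Injective C.incl := Subtype.val_injective

theorem map_incl_injective : Function.Injective (TensorProduct.map C.incl C.incl) :=
  TensorProduct.map_injective_of_flat_flat _ _ C.incl_injective C.incl_injective

/-- The comultiplication of `A` restricted to `C → C ⊗ C`. -/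
noncomputable def comulRestrict : C →ₗ[K] C ⊗[K] C :=
  (LinearEquiv.ofInjective _ C.map_incl_injective).symm.toLinearMap ∘ₗ
    (Coalgebra.comul ∘ₗ C.incl).codRestrict _ (fun x => C.comul_mem' x x.2)

theorem map_comulRestrict (x : C) :
    TensorProduct.map C.incl C.incl (C.comulRestrict x) = Coalgebra.comul (R := K) (x : A) :=
  congrArg Subtype.val ((LinearEquiv.ofInjective _ C.map_incl_injective).apply_symm_apply
    ((Coalgebra.comul ∘ₗ C.incl).codRestrict _ (fun x => C.comul_mem' x x.2) x))

theorem map_comp_comulRestrict :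
    TensorProduct.map C.incl C.incl ∘ₗ C.comulRestrict = Coalgebra.comul ∘ₗ C.incl :=
  LinearMap.ext C.map_comulRestrict

noncomputable instance : Coalgebra K C where
  comul := C.comulRestrict
  counit := Coalgebra.counit ∘ₗ C.incl
  coassoc := by
    have hinj : Function.Injective
        (TensorProduct.map C.incl (TensorProduct.map C.incl C.incl)) :=
      TensorProduct.map_injective_of_flat_flat _ _ C.incl_injective C.map_incl_injective
    rw [← LinearMap.cancel_left hinj]
    have h1 : TensorProduct.map C.incl (TensorProduct.map C.incl C.incl) ∘ₗ
        (TensorProduct.assoc K C C C).toLinearMap =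
        (TensorProduct.assoc K A A A).toLinearMap ∘ₗ
          TensorProduct.map (TensorProduct.map C.incl C.incl) C.incl := by
      ext; rfl
    ext x
    have h2 := Coalgebra.coassoc_apply (R := K) (x : A)
    rw [← C.map_comulRestrict, ← LinearMap.comp_apply (LinearMap.rTensor _ _),
      ← LinearMap.comp_apply (LinearMap.lTensor _ _), LinearMap.rTensor_comp_map,
      LinearMap.lTensor_comp_map, ← C.map_comp_comulRestrict, ← LinearMap.map_comp_rTensor,
      ← LinearMap.map_comp_lTensor] at h2
    rw [← LinearMap.comp_assoc, h1]
    exact h2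
  rTensor_counit_comp_comul := by
    have hinj : Function.Injective (C.incl.lTensor K) :=
      Module.Flat.lTensor_preserves_injective_linearMap _ C.incl_injective
    rw [← LinearMap.cancel_left hinj]
    ext x
    have h := Coalgebra.rTensor_counit_comul (R := K) (x : A)
    rw [← C.map_comulRestrict, ← LinearMap.comp_apply, LinearMap.rTensor_comp_map] at h
    rw [← LinearMap.comp_assoc, LinearMap.lTensor_comp_rTensor]
    exact h
  lTensor_counit_comp_comul := by
    have hinj : Function.Injective (C.incl.rTensor K) :=
      Module.Flat.rTensor_preserves_injective_linearMap _ C.incl_injective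
    rw [← LinearMap.cancel_left hinj]
    ext x
    have h := Coalgebra.lTensor_counit_comul (R := K) (x : A)
    rw [← C.map_comulRestrict, ← LinearMap.comp_apply, LinearMap.lTensor_comp_map] at h
    rw [← LinearMap.comp_assoc, LinearMap.rTensor_comp_lTensor]
    exact h

theorem map_comul (x : C) :
    TensorProduct.map C.incl C.incl (Coalgebra.comul (R := K) x)
      = Coalgebra.comul (R := K) (x : A) :=
  C.map_comulRestrict x

theorem counit_coe (x : C) :
    Coalgebra.counit (R := K) x = Coalgebra.counit (R := K) (x : A) := rfl

theorem map_incl_eq_algHom (z : C ⊗[K] C) : TensorProduct.map C.incl C.incl z =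
    Algebra.TensorProduct.map C.toSubalgebra.val C.toSubalgebra.val z := rfl

noncomputable instance : Bialgebra K C :=
  Bialgebra.mk' K C
    (by rw [C.counit_coe]; exact Bialgebra.counit_one)
    (by intro a b; simp only [C.counit_coe]; exact Bialgebra.counit_mul (a : A) b)
    (by
      apply C.map_incl_injective
      rw [C.map_comul, C.map_incl_eq_algHom, map_one]
      exact Bialgebra.comul_one)
    (by
      intro a b
      apply C.map_incl_injective
      rw [C.map_comul, C.map_incl_eq_algHom, map_mul, ← C.map_incl_eq_algHom,
        ← C.map_incl_eq_algHom, C.map_comul, C.map_comul]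
      exact Bialgebra.comul_mul (a : A) b)

/-- The antipode of `A` restricted to `C → C`. -/
noncomputable def antipodeRestrict : C →ₗ[K] C :=
  (HopfAlgebra.antipode K ∘ₗ C.incl).codRestrict (Subalgebra.toSubmodule C.toSubalgebra)
    (fun x => C.antipode_mem' x x.2)

theorem incl_comp_antipodeRestrict :
    C.incl ∘ₗ C.antipodeRestrict = HopfAlgebra.antipode K ∘ₗ C.incl := rfl

theorem incl_comp_mul' : C.incl ∘ₗ LinearMap.mul' K C =
    LinearMap.mul' K A ∘ₗ TensorProduct.map C.incl C.incl := by
  ext; rfl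

/-- A Hopf subalgebra is a Hopf algebra, with all operations restricted from `A`. -/
noncomputable instance : HopfAlgebra K C where
  antipode := C.antipodeRestrict
  mul_antipode_rTensor_comul := by
    rw [← LinearMap.cancel_left C.incl_injective, ← LinearMap.comp_assoc, C.incl_comp_mul']
    ext x
    have h := HopfAlgebra.mul_antipode_rTensor_comul_apply (R := K) (x : A)
    rw [← C.map_comul, ← LinearMap.comp_apply (LinearMap.rTensor _ _),
      LinearMap.rTensor_comp_map, ← C.incl_comp_antipodeRestrict, ← LinearMap.map_comp_rTensor] at h
    exact h
  mul_antipode_lTensor_comul := by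
    rw [← LinearMap.cancel_left C.incl_injective, ← LinearMap.comp_assoc, C.incl_comp_mul']
    ext x
    have h := HopfAlgebra.mul_antipode_lTensor_comul_apply (R := K) (x : A)
    rw [← C.map_comul, ← LinearMap.comp_apply (LinearMap.lTensor _ _),
      LinearMap.lTensor_comp_map, ← C.incl_comp_antipodeRestrict, ← LinearMap.map_comp_lTensor] at h
    exact h

instance [Coalgebra.IsCocomm K A] : Coalgebra.IsCocomm K C where
  comm_comp_comul := by
    ext x
    apply C.map_incl_injective
    have h := Coalgebra.comm_comul K (x : A)
    rw [← C.map_comul] at h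
    rw [LinearMap.comp_apply, LinearEquiv.coe_coe, TensorProduct.map_comm]
    exact h

/-- The inclusion `C → A` as a morphism of Hopf algebras. -/
noncomputable def inclusion : C →ₐc[K] A :=
  BialgHom.ofAlgHom C.toSubalgebra.val
    (by ext x; rfl)
    (by ext x; exact C.map_comul x)

/-- The augmentation part `C⁺ = {x ∈ C | ε(x) = 0}`, as a subspace of `A`. -/
def augmentation : Submodule K A :=
  Subalgebra.toSubmodule C.toSubalgebra ⊓ LinearMap.ker (Coalgebra.counit (R := K) (A := A))

end Structure

section HInverse

variable {K : Type u} {A B : Type v} [Field K] [Ring A] [Ring B] [HopfAlgebra K A]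
  [HopfAlgebra K B]

/-- The set `{x ∈ A | (p ⊗ id) Δ(x) - 1 ⊗ x ∈ C⁺ ⊗ A}`, where `C⁺ ⊗ A` is viewed inside
`B ⊗ A`. -/
def hInverseSet (p : A →ₐc[K] B) (C : HopfSubalgebra K B) : Set A :=
  {x | TensorProduct.map p.toCoalgHom.toLinearMap LinearMap.id (Coalgebra.comul (R := K) x)
      - (1 : B) ⊗ₜ[K] x ∈
    LinearMap.range (TensorProduct.map C.augmentation.subtype (LinearMap.id : A →ₗ[K] A))}

/-- The algebra morphism `x ↦ p(x₁) ⊗ x₂`. -/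
noncomputable def coaction (p : A →ₐc[K] B) : A →ₐ[K] B ⊗[K] A :=
  (Algebra.TensorProduct.map (AlgHomClass.toAlgHom p) (AlgHom.id K A)).comp
    (Bialgebra.comulAlgHom K A)

theorem coaction_apply (p : A →ₐc[K] B) (x : A) : coaction p x =
    TensorProduct.map p.toCoalgHom.toLinearMap LinearMap.id (Coalgebra.comul (R := K) x) := rfl

theorem counit_coaction (p : A →ₐc[K] B) (x : A) :
    TensorProduct.map (Coalgebra.counit (R := K)) LinearMap.id (coaction p x)
      = (1 : K) ⊗ₜ[K] x := by
  rw [coaction_apply, ← LinearMap.comp_apply, ← TensorProduct.map_comp,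
    ← Coalgebra.rTensor_counit_comul, LinearMap.rTensor, p.toCoalgHom.counit_comp]
  rfl

/-- The subalgebra of those `x` with `p(x₁) ⊗ x₂ ∈ C ⊗ A`. -/
noncomputable def hInverseSubalgebra (p : A →ₐc[K] B) (C : HopfSubalgebra K B) :
    Subalgebra K A :=
  (Algebra.TensorProduct.map C.toSubalgebra.val (AlgHom.id K A)).range.comap (coaction p)

theorem mem_hInverseSubalgebra (p : A →ₐc[K] B) (C : HopfSubalgebra K B) (x : A) :
    x ∈ hInverseSubalgebra p C ↔
      coaction p x ∈ LinearMap.range (TensorProduct.map C.incl (LinearMap.id : A →ₗ[K] A)) :=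
  Iff.rfl

theorem coe_hInverseSubalgebra (p : A →ₐc[K] B) (C : HopfSubalgebra K B) :
    (hInverseSubalgebra p C : Set A) = hInverseSet p C := by
  ext x
  rw [SetLike.mem_coe, mem_hInverseSubalgebra]
  change _ ↔ coaction p x - (1 : B) ⊗ₜ[K] x ∈ LinearMap.range
    (TensorProduct.map C.augmentation.subtype (LinearMap.id : A →ₗ[K] A))
  constructor
  · intro hx
    have hy : coaction p x - (1 : B) ⊗ₜ[K] x ∈
        LinearMap.range (TensorProduct.map C.incl (LinearMap.id : A →ₗ[K] A)) :=
      Submodule.sub_mem _ hx ⟨(1 : C) ⊗ₜ x, rfl⟩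
    have h0 : TensorProduct.map (Coalgebra.counit (R := K)) LinearMap.id
        (coaction p x - (1 : B) ⊗ₜ[K] x) = 0 := by
      rw [map_sub, counit_coaction, TensorProduct.map_tmul, Bialgebra.counit_one]
      exact sub_self _
    generalize coaction p x - (1 : B) ⊗ₜ[K] x = y at hy h0
    obtain ⟨z, rfl⟩ := hy
    have key : ∀ z : C ⊗[K] A, TensorProduct.map C.incl LinearMap.id z -
        TensorProduct.map (Algebra.linearMap K B) LinearMap.id
          (TensorProduct.map (Coalgebra.counit (R := K)) LinearMap.id
            (TensorProduct.map C.incl (LinearMap.id : A →ₗ[K] A) z)) ∈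
        LinearMap.range
          (TensorProduct.map C.augmentation.subtype (LinearMap.id : A →ₗ[K] A)) := by
      intro z
      induction z with
      | zero => simp
      | add z w hz hw =>
        simp only [map_add]
        rw [add_sub_add_comm]
        exact Submodule.add_mem _ hz hw
      | tmul c a =>
        refine ⟨(⟨(c : B) - algebraMap K B (Coalgebra.counit (R := K) (c : B)), ?_, ?_⟩ :
          C.augmentation) ⊗ₜ a, ?_⟩
        · exact Subalgebra.sub_mem _ c.2 (Subalgebra.algebraMap_mem _ _)
        · change Coalgebra.counit (R := K) _ = (0 : K)
          rw [map_sub, Bialgebra.counit_algebraMap, sub_self]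
        · simp only [TensorProduct.map_tmul, LinearMap.id_apply, Submodule.subtype_apply,
            TensorProduct.sub_tmul]
          rfl
    have := key z
    rwa [h0, map_zero, sub_zero] at this
  · intro hx
    rw [← sub_add_cancel (coaction p x) ((1 : B) ⊗ₜ[K] x)]
    refine Submodule.add_mem _ ?_ ⟨(1 : C) ⊗ₜ x, rfl⟩
    have hle : LinearMap.range
        (TensorProduct.map C.augmentation.subtype (LinearMap.id : A →ₗ[K] A)) ≤
        LinearMap.range (TensorProduct.map C.incl (LinearMap.id : A →ₗ[K] A)) := by
      rintro _ ⟨z, rfl⟩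
      induction z with
      | zero => simp
      | add z w hz hw => rw [map_add]; exact Submodule.add_mem _ hz hw
      | tmul c a => exact ⟨(⟨c, c.2.1⟩ : C) ⊗ₜ a, rfl⟩
    exact hle hx

theorem map_mem_of_mem_hInverseSubalgebra (p : A →ₐc[K] B) (C : HopfSubalgebra K B) {x : A}
    (hx : x ∈ hInverseSubalgebra p C) : p x ∈ C.toSubalgebra := by
  obtain ⟨z, hz⟩ := (mem_hInverseSubalgebra p C x).1 hx
  have h1 : ∀ z : C ⊗[K] A, TensorProduct.rid K B (TensorProduct.map LinearMap.id
      (Coalgebra.counit (R := K)) (TensorProduct.map C.incl (LinearMap.id : A →ₗ[K] A) z)) ∈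
      C.toSubalgebra := by
    intro z
    induction z with
    | zero => simp
    | add z w hz hw => simp only [map_add]; exact Subalgebra.add_mem _ hz hw
    | tmul c a =>
      simp only [TensorProduct.map_tmul, LinearMap.id_apply, TensorProduct.rid_tmul]
      exact Subalgebra.smul_mem _ c.2 _
  have h2 : TensorProduct.rid K B (TensorProduct.map LinearMap.id
      (Coalgebra.counit (R := K)) (coaction p x)) = p x := by
    rw [coaction_apply, ← LinearMap.comp_apply, ← TensorProduct.map_comp]
    have h3 := congrArg (TensorProduct.map p.toCoalgHom.toLinearMap LinearMap.id)
      (Coalgebra.lTensor_counit_comul (R := K) x)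
    rw [LinearMap.lTensor, ← LinearMap.comp_apply, ← TensorProduct.map_comp] at h3
    rw [LinearMap.id_comp, LinearMap.comp_id] at h3 ⊢
    rw [h3, TensorProduct.map_tmul, TensorProduct.rid_tmul, LinearMap.id_apply, one_smul]
    rfl
  rw [← h2, ← hz]
  exact h1 z

/-- The linear map `x ↦ [p(x₁)] ⊗ x₂` with values in `B/C ⊗ A`. -/
noncomputable def quotientCoaction (p : A →ₐc[K] B) (C : HopfSubalgebra K B) :
    A →ₗ[K] (B ⧸ Subalgebra.toSubmodule C.toSubalgebra) ⊗[K] A :=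
  (Subalgebra.toSubmodule C.toSubalgebra).mkQ.rTensor A ∘ₗ (coaction p).toLinearMap

theorem ker_quotientCoaction (p : A →ₐc[K] B) (C : HopfSubalgebra K B) :
    LinearMap.ker (quotientCoaction p C) =
      Subalgebra.toSubmodule (hInverseSubalgebra p C) := by
  ext x
  have h := rTensor_exact A
    (LinearMap.exact_subtype_mkQ (Subalgebra.toSubmodule C.toSubalgebra))
    (Submodule.mkQ_surjective _) (coaction p x)
  exact h

theorem rTensor_quotientCoaction_comul (p : A →ₐc[K] B) (C : HopfSubalgebra K B) (x : A) :
    (quotientCoaction p C).rTensor A (Coalgebra.comul (R := K) x) =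
      (TensorProduct.assoc K _ A A).symm
        ((Coalgebra.comul (R := K)).lTensor _ (quotientCoaction p C x)) := by
  rw [LinearEquiv.eq_symm_apply]
  set f := (Subalgebra.toSubmodule C.toSubalgebra).mkQ ∘ₗ p.toCoalgHom.toLinearMap with hf
  have hq : quotientCoaction p C = f.rTensor A ∘ₗ Coalgebra.comul := by
    rw [hf, LinearMap.rTensor_comp]
    rfl
  have h := congrArg (f.rTensor (A ⊗[K] A)) (Coalgebra.coassoc_apply (R := K) x)
  rw [hq, LinearMap.rTensor_comp, LinearMap.comp_apply, LinearMap.comp_apply]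
  rw [← LinearMap.comp_apply, ← LinearMap.comp_apply (LinearMap.lTensor _ _),
    LinearMap.lTensor_comp_rTensor, ← LinearMap.rTensor_comp_lTensor, LinearMap.comp_apply,
    LinearMap.comp_apply, ← h]
  generalize (LinearMap.rTensor A Coalgebra.comul (Coalgebra.comul (R := K) x)) = z
  have h4 : (TensorProduct.assoc K _ A A).toLinearMap ∘ₗ (f.rTensor A).rTensor A =
      f.rTensor (A ⊗[K] A) ∘ₗ (TensorProduct.assoc K A A A).toLinearMap := by
    ext; rfl
  exact LinearMap.congr_fun h4 z

theorem comul_mem_hInverseSubalgebra [Coalgebra.IsCocomm K A] (p : A →ₐc[K] B)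
    (C : HopfSubalgebra K B) {x : A} (hx : x ∈ hInverseSubalgebra p C) :
    Coalgebra.comul (R := K) x ∈ LinearMap.range (TensorProduct.map
      (hInverseSubalgebra p C).val.toLinearMap (hInverseSubalgebra p C).val.toLinearMap) := by
  have hex : Function.Exact (hInverseSubalgebra p C).val.toLinearMap (quotientCoaction p C) := by
    intro y
    rw [← LinearMap.mem_ker, ker_quotientCoaction]
    exact ⟨fun h => ⟨⟨y, h⟩, rfl⟩, fun ⟨z, hz⟩ => hz ▸ z.2⟩
  have hx0 : quotientCoaction p C x = 0 := by
    rw [← LinearMap.mem_ker, ker_quotientCoaction]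
    exact hx
  have h1 : (quotientCoaction p C).rTensor A (Coalgebra.comul (R := K) x) = 0 := by
    rw [rTensor_quotientCoaction_comul, hx0, map_zero, map_zero]
  have h2 : (quotientCoaction p C).lTensor A (Coalgebra.comul (R := K) x) = 0 := by
    rw [← Coalgebra.comm_comul K x, LinearMap.lTensor, TensorProduct.map_comm]
    exact (congrArg _ h1).trans (map_zero _)
  obtain ⟨z, hz⟩ := (Module.Flat.rTensor_exact A hex _).1 h1
  have h3 : (quotientCoaction p C).lTensor (hInverseSubalgebra p C) z = 0 := by
    apply Module.Flat.rTensor_preserves_injective_linearMap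
      (M := (B ⧸ Subalgebra.toSubmodule C.toSubalgebra) ⊗[K] A)
      (hInverseSubalgebra p C).val.toLinearMap Subtype.val_injective
    rw [map_zero, ← LinearMap.comp_apply, LinearMap.rTensor_comp_lTensor,
      ← LinearMap.lTensor_comp_rTensor, LinearMap.comp_apply, hz, h2]
  obtain ⟨w, hw⟩ := (Module.Flat.lTensor_exact (hInverseSubalgebra p C) hex _).1 h3
  refine ⟨w, ?_⟩
  rw [← hz, ← hw, ← LinearMap.comp_apply, LinearMap.rTensor_comp_lTensor]

theorem antipode_mem_hInverseSubalgebra [Coalgebra.IsCocomm K A] (p : A →ₐc[K] B)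
    (C : HopfSubalgebra K B) {x : A} (hx : x ∈ hInverseSubalgebra p C) :
    HopfAlgebra.antipode K x ∈ hInverseSubalgebra p C := by
  rw [mem_hInverseSubalgebra] at hx ⊢
  have h1 : coaction p (HopfAlgebra.antipode K x) =
      TensorProduct.map (HopfAlgebra.antipode K) (HopfAlgebra.antipode K) (coaction p x) := by
    have hp : p.toCoalgHom.toLinearMap ∘ₗ HopfAlgebra.antipode K =
        HopfAlgebra.antipode K ∘ₗ p.toCoalgHom.toLinearMap :=
      LinearMap.ext p.apply_antipode
    rw [coaction_apply, coaction_apply, HopfAlgebra.comul_antipode_of_isCocomm,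
      ← LinearMap.comp_apply (TensorProduct.map _ _),
      ← LinearMap.comp_apply (TensorProduct.map _ _), ← TensorProduct.map_comp,
      ← TensorProduct.map_comp, hp, LinearMap.id_comp, LinearMap.comp_id]
  obtain ⟨z, hz⟩ := hx
  rw [h1, ← hz]
  refine ⟨TensorProduct.map (HopfAlgebra.antipode K) (HopfAlgebra.antipode K) z, ?_⟩
  rw [← LinearMap.comp_apply, ← LinearMap.comp_apply, ← TensorProduct.map_comp,
    ← TensorProduct.map_comp]
  rfl

/-- The h-inverse `p⁻¹(C) = {x ∈ A | (p ⊗ id) Δ(x) - 1 ⊗ x ∈ C⁺ ⊗ A}`, a Hopf subalgebra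
of `A`. -/
noncomputable def hInverse [Coalgebra.IsCocomm K A] (p : A →ₐc[K] B) (C : HopfSubalgebra K B) :
    HopfSubalgebra K A where
  toSubalgebra := (hInverseSubalgebra p C).copy (hInverseSet p C)
    (coe_hInverseSubalgebra p C).symm
  comul_mem' x hx := by
    rw [Subalgebra.copy_eq]
    exact comul_mem_hInverseSubalgebra p C ((coe_hInverseSubalgebra p C).ge hx)
  antipode_mem' x hx := (coe_hInverseSubalgebra p C).le
    (antipode_mem_hInverseSubalgebra p C ((coe_hInverseSubalgebra p C).ge hx))

theorem coe_hInverse [Coalgebra.IsCocomm K A] (p : A →ₐc[K] B) (C : HopfSubalgebra K B) :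
    ((hInverse p C).toSubalgebra : Set A) = hInverseSet p C := rfl

theorem map_mem_of_mem_hInverse [Coalgebra.IsCocomm K A] (p : A →ₐc[K] B)
    (C : HopfSubalgebra K B) (x : hInverse p C) : p (x : A) ∈ C.toSubalgebra :=
  map_mem_of_mem_hInverseSubalgebra p C ((coe_hInverseSubalgebra p C).ge x.2)

theorem map_incl_map_restrict [Coalgebra.IsCocomm K A] (p : A →ₐc[K] B)
    (C : HopfSubalgebra K B) (z : hInverse p C ⊗[K] hInverse p C) :
    TensorProduct.map C.incl C.incl (Algebra.TensorProduct.map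
      (((AlgHomClass.toAlgHom p).comp (hInverse p C).toSubalgebra.val).codRestrict C.toSubalgebra
        (map_mem_of_mem_hInverse p C))
      (((AlgHomClass.toAlgHom p).comp (hInverse p C).toSubalgebra.val).codRestrict C.toSubalgebra
        (map_mem_of_mem_hInverse p C)) z) =
      TensorProduct.map (p : A →ₗ[K] B) (p : A →ₗ[K] B)
        (TensorProduct.map (hInverse p C).incl (hInverse p C).incl z) := by
  induction z with
  | zero => simp only [map_zero]
  | add z w hz hw => simp only [map_add, hz, hw]
  | tmul a b => rfl

/-- The restriction `x ↦ p x` of `p` to a morphism of Hopf algebras `p⁻¹(C) → C`. -/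
noncomputable def hInverseRestrict [Coalgebra.IsCocomm K A] (p : A →ₐc[K] B)
    (C : HopfSubalgebra K B) : hInverse p C →ₐc[K] C :=
  BialgHom.ofAlgHom
    (((AlgHomClass.toAlgHom p).comp (hInverse p C).toSubalgebra.val).codRestrict C.toSubalgebra
      (map_mem_of_mem_hInverse p C))
    (by
      ext x
      exact CoalgHomClass.counit_comp_apply p (x : A))
    (by
      ext x
      apply C.map_incl_injective
      refine Eq.trans ?_ (C.map_comul _).symm
      refine Eq.trans ?_ (CoalgHomClass.map_comp_comul_apply p (x : A))
      rw [← (hInverse p C).map_comul]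
      exact map_incl_map_restrict p C (Coalgebra.comul (R := K) x))

theorem hInverseRestrict_coe [Coalgebra.IsCocomm K A] (p : A →ₐc[K] B)
    (C : HopfSubalgebra K B) (x : hInverse p C) :
    (hInverseRestrict p C x : B) = p (x : A) := rfl

end HInverse

end HopfSubalgebra

/-- The category of cocommutative Hopf algebras over `K`, as a full subcategory of the category
of Hopf algebras over `K`. -/
abbrev CocommHopfAlgCat (K : Type u) [Field K] :=
  CategoryTheory.ObjectProperty.FullSubcategory
    (fun A : HopfAlgCat.{v} K => Coalgebra.IsCocomm K A)

namespace CocommHopfAlgCat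

variable {K : Type u} [Field K]

/-- A cocommutative Hopf algebra as an object of the category. -/
abbrev of (K : Type u) [Field K] (A : Type v) [Ring A] [HopfAlgebra K A]
    [h : Coalgebra.IsCocomm K A] : CocommHopfAlgCat.{u, v} K :=
  ⟨HopfAlgCat.of K A, h⟩

/-- A morphism of Hopf algebras as a morphism of the category. -/
abbrev ofHom {A B : Type v} [Ring A] [Ring B] [HopfAlgebra K A] [HopfAlgebra K B]
    [Coalgebra.IsCocomm K A] [Coalgebra.IsCocomm K B] (f : A →ₐc[K] B) :
    CocommHopfAlgCat.of K A ⟶ CocommHopfAlgCat.of K B :=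
  CategoryTheory.ObjectProperty.homMk (HopfAlgCat.ofHom f)

/-- The morphism of Hopf algebras underlying a morphism of the category. -/
abbrev toBialgHom {X Y : CocommHopfAlgCat.{u, v} K} (f : X ⟶ Y) : X.obj →ₐc[K] Y.obj :=
  f.hom.toBialgHom

end CocommHopfAlgCat

/-!
That the h-inverse `p⁻¹(C)` is the pullback is formal: a morphism `g` into `A` for which `p ∘ g`
factors through `C` takes values in `p⁻¹(C)` (`HopfSubalgebra.mem_hInverse_of_map_mem`). The content
is the surjectivity of `p⁻¹(C) → C`, which then passes to every other pullback. It is an instance of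
the exactness of the cotensor product with `A` over `B`
(`exists_lTensor_rightCoaction_eq_zero`): if `c ∈ B` satisfies `c₍₁₎ ⊗ ψ c₍₂₎ = 0`, where `ψ` is here
the projection `B → B / C`, then `c = p x` for some `x ∈ A` with `x₍₁₎ ⊗ ψ (p x₍₂₎) = 0`. This
statement descends from an extension of the base field, so the field `k` may be taken algebraically
closed.

Let `K` be the Hopf kernel of `p` and `K⁺` its augmentation ideal. The map `a ↦ a₍₁₎ ⊗ ψ (p a₍₂₎)`
is a morphism of Hopf modules (`K`-modules with a compatible coaction of `A`) from `A` to `A ⊗ V`.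
Two facts finish the proof.

* Passing from a Hopf module `N` to `N / K⁺N` is exact (`LeftCoaction.IsHopfModule.inf_smul_top_le`
  and `LeftCoaction.IsHopfModule.exists_sub_mem_smul_top`). The functionals on `A` act on a comodule
  by commuting locally finite operators, as `A` is cocommutative, so a nonzero comodule over an
  algebraically closed field contains an eigenvector, on which `A` coacts through a group-like
  element (`LeftCoaction.exists_isGroupLikeElem`). Hence every proper Hopf submodule of `N` can be
  enlarged by a cyclic module which is free over `K`
  (`LeftCoaction.IsHopfModule.eq_zero_of_smul_mem`), and exactness follows by Zorn's lemma.
* Newman's theorem `ker p = K⁺A` (`mem_smul_top_of_map_eq_zero`). If it failed, `ker p / K⁺A`, a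
  comodule over `B`, would contain an eigenvector with group-like element `h ∈ B`. By the exactness
  above it lifts to an element `y ∈ ker p` outside `K⁺A` with `y₍₁₎ ⊗ p y₍₂₎ = y ⊗ h`. Then `h = p g`
  for a group-like element `g` of `A`, and `y g⁻¹` lies in `K⁺`, a contradiction.
-/

section

/-! ### Slice maps on tensor products -/

section Slice

variable {k X Y Z : Type*} [Field k] [AddCommGroup X] [Module k X] [AddCommGroup Y] [Module k Y]
  [AddCommGroup Z] [Module k Z]

/-- The slice map `x ⊗ y ↦ f x • y` of a linear functional `f` on the left tensor factor. -/
noncomputable def leftSlice (f : Module.Dual k X) : X ⊗[k] Y →ₗ[k] Y :=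
  (TensorProduct.lid k Y).toLinearMap ∘ₗ f.rTensor Y

@[simp] theorem leftSlice_tmul (f : Module.Dual k X) (x : X) (y : Y) :
    leftSlice f (x ⊗ₜ[k] y) = f x • y := rfl

theorem leftSlice_lTensor (f : Module.Dual k X) (φ : Y →ₗ[k] Z) (t : X ⊗[k] Y) :
    leftSlice f (φ.lTensor X t) = φ (leftSlice f t) := by
  induction t with
  | zero => simp
  | add s t hs ht => simp only [map_add, hs, ht]
  | tmul x y => simp

/-- Over a field, the slice maps separate the points of a tensor product. -/
theorem eq_zero_of_leftSlice_eq_zero {t : X ⊗[k] Y}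
    (h : ∀ f : Module.Dual k X, leftSlice f t = 0) : t = 0 := by
  classical
  let b := Module.Basis.ofVectorSpace k X
  apply (TensorProduct.equivFinsuppOfBasisLeft (N := Y) b).injective
  ext i
  rw [TensorProduct.equivFinsuppOfBasisLeft_apply, map_zero]
  exact h (b.coord i)

/-- The slices of a fixed tensor lie in a finite-dimensional space. -/
theorem exists_finiteDimensional_leftSlice_mem (t : X ⊗[k] Y) :
    ∃ W : Submodule k Y, FiniteDimensional k W ∧ ∀ f : Module.Dual k X, leftSlice f t ∈ W := by
  induction t with
  | zero => exact ⟨⊥, inferInstance, fun f => by simp⟩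
  | add s t hs ht =>
    obtain ⟨W, _, hW⟩ := hs
    obtain ⟨W', _, hW'⟩ := ht
    refine ⟨W ⊔ W', inferInstance, fun f => ?_⟩
    rw [map_add]
    exact Submodule.add_mem_sup (hW f) (hW' f)
  | tmul x y =>
    exact ⟨k ∙ y, inferInstance, fun f =>
      Submodule.smul_mem _ _ (Submodule.mem_span_singleton_self y)⟩

end Slice

/-! ### Common eigenvectors modulo a stable subspace -/

section Eigenvector

variable {k N ι : Type*} [Field k] [IsAlgClosed k] [AddCommGroup N] [Module k N]

/-- Let `T` be a commuting family of operators preserving a subspace `M`. A finite-dimensional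
`T`-stable subspace not contained in `M` contains a common eigenvector modulo `M`. -/
theorem exists_eigenvector_of_finiteDimensional {T : ι → Module.End k N}
    (hT : ∀ i j n, T i (T j n) = T j (T i n)) {M : Submodule k N} (hM : ∀ i, ∀ m ∈ M, T i m ∈ M)
    (W : Submodule k N) [FiniteDimensional k W] (hW : ∀ i, ∀ w ∈ W, T i w ∈ W) (hWM : ¬ W ≤ M) :
    ∃ w ∈ W, w ∉ M ∧ ∀ i, ∃ c : k, T i w - c • w ∈ M := by
  induction hd : Module.finrank k W using Nat.strong_induction_on generalizing W with
  | _ d ih =>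
  by_cases hall : ∀ i, ∃ c : k, ∀ w ∈ W, T i w - c • w ∈ M
  · obtain ⟨w, hw, hwM⟩ := SetLike.not_le_iff_exists.1 hWM
    exact ⟨w, hw, hwM, fun i => (hall i).imp fun c hc => hc w hw⟩
  push Not at hall
  obtain ⟨i, hi⟩ := hall
  -- The operator induced by `T i` on `W / (W ∩ M)` has an eigenvalue.
  let P : Submodule k W := M.comap W.subtype
  let Ti : Module.End k W := (T i).restrict (hW i)
  have hP : P ≤ P.comap Ti := fun w hw => hM i _ hw
  have : Nontrivial (W ⧸ P) := by
    rw [Submodule.Quotient.nontrivial_iff]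
    intro htop
    exact hWM fun w hw => (htop ▸ Submodule.mem_top : (⟨w, hw⟩ : W) ∈ P)
  obtain ⟨c, hc⟩ := Module.End.exists_eigenvalue (P.mapQ P Ti hP)
  obtain ⟨x, hx⟩ := hc.exists_hasEigenvector
  obtain ⟨w, rfl⟩ := P.mkQ_surjective x
  have hwM : (w : N) ∉ M := fun h => hx.2 ((Submodule.Quotient.mk_eq_zero P).2 h)
  have hwc : T i w - c • (w : N) ∈ M := by
    have := hx.apply_eq_smul
    rw [Submodule.mkQ_apply, Submodule.mapQ_apply, ← Submodule.Quotient.mk_smul,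
      Submodule.Quotient.eq] at this
    exact this
  -- The vectors of `W` on which `T i` is the scalar `c` modulo `M` form a smaller space.
  let W' : Submodule k N := W ⊓ M.comap (T i - c • LinearMap.id)
  have hmem : ∀ n, n ∈ W' ↔ n ∈ W ∧ T i n - c • n ∈ M := fun n => Iff.rfl
  have hlt : W' < W := by
    refine lt_of_le_of_ne inf_le_left fun h => ?_
    obtain ⟨v, hv, hvM⟩ := hi c
    rw [← h] at hv
    exact hvM hv.2
  have hfin : FiniteDimensional k W' := Submodule.finiteDimensional_of_le hlt.le
  obtain ⟨v, hv, h⟩ := ih _ (hd ▸ Submodule.finrank_lt_finrank_of_lt hlt) W'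
    (fun j v hv => by
      rw [hmem] at hv ⊢
      refine ⟨hW j v hv.1, ?_⟩
      rw [hT, ← map_smul, ← map_sub]
      exact hM j _ hv.2)
    (fun hle => hwM (hle ((hmem _).2 ⟨w.2, hwc⟩))) rfl
  exact ⟨v, hlt.le hv, h⟩

end Eigenvector

/-! ### Comodules over cocommutative coalgebras -/

open Coalgebra HopfAlgebra

/-- A left coaction of a coalgebra `H` on a vector space `N`. -/
structure LeftCoaction (k H N : Type*) [Field k] [AddCommGroup H] [Module k H] [Coalgebra k H]
    [AddCommGroup N] [Module k N] where
  /-- The structure map `N → H ⊗ N`. -/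
  coact : N →ₗ[k] H ⊗[k] N
  coassoc : ∀ n, TensorProduct.assoc k H H N ((comul (R := k)).rTensor N (coact n)) =
    coact.lTensor H (coact n)
  counit_coact : ∀ n, leftSlice (counit (R := k)) (coact n) = n

namespace LeftCoaction

variable {k H N : Type*} [Field k] [AddCommGroup H] [Module k H] [Coalgebra k H]
    [AddCommGroup N] [Module k N] (ρ : LeftCoaction k H N)

/-- The operator `n ↦ f n₍₋₁₎ • n₍₀₎` through which a functional `f` on `H` acts on a comodule. -/
noncomputable def op (f : Module.Dual k H) : Module.End k N := leftSlice f ∘ₗ ρ.coact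

theorem op_apply (f : Module.Dual k H) (n : N) : ρ.op f n = leftSlice f (ρ.coact n) := rfl

theorem op_counit (n : N) : ρ.op (counit (R := k)) n = n := ρ.counit_coact n

/-- The action of functionals is contravariant for the convolution product. -/
theorem op_op (f g : Module.Dual k H) (n : N) :
    ρ.op g (ρ.op f n) = ρ.op (g ∘ₗ leftSlice f ∘ₗ comul) n := by
  have h : ∀ t : H ⊗[k] N, leftSlice g (leftSlice f
      (TensorProduct.assoc k H H N ((comul (R := k)).rTensor N t))) =
      leftSlice (g ∘ₗ leftSlice f ∘ₗ comul) t := by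
    intro t
    induction t with
    | zero => simp
    | add s t hs ht => simp only [map_add, hs, ht]
    | tmul x n =>
      rw [LinearMap.rTensor_tmul, leftSlice_tmul, LinearMap.comp_apply, LinearMap.comp_apply]
      generalize comul (R := k) x = z
      induction z with
      | zero => simp
      | add s t hs ht => simp only [map_add, TensorProduct.add_tmul, add_smul, hs, ht]
      | tmul x y => simp [smul_smul]
  rw [op_apply, op_apply, op_apply, ← leftSlice_lTensor, ← ρ.coassoc, h]

theorem op_comm [IsCocomm k H] (f g : Module.Dual k H) (n : N) :
    ρ.op g (ρ.op f n) = ρ.op f (ρ.op g n) := by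
  have h : g ∘ₗ leftSlice f ∘ₗ comul = f ∘ₗ leftSlice g ∘ₗ (comul : H →ₗ[k] H ⊗[k] H) := by
    ext x
    simp only [LinearMap.comp_apply]
    conv_lhs => rw [← comm_comul k x]
    generalize comul (R := k) x = z
    induction z with
    | zero => simp
    | add s t hs ht => simp only [map_add, hs, ht]
    | tmul x y => simp [mul_comm]
  rw [op_op, op_op, h]

/-- A subspace stable under all the operators `op f`; over a field, these are the subcomodules. -/
def IsStable (M : Submodule k N) : Prop := ∀ f : Module.Dual k H, ∀ m ∈ M, ρ.op f m ∈ M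

/-- Over an algebraically closed field, a nonzero subquotient of a comodule over a cocommutative
coalgebra contains a vector on which the coalgebra coacts through a group-like element. -/
theorem exists_isGroupLikeElem [IsAlgClosed k] [IsCocomm k H] {N₀ M : Submodule k N}
    (hN₀ : ρ.IsStable N₀) (hM : ρ.IsStable M) (hle : ¬ N₀ ≤ M) :
    ∃ m ∈ N₀, m ∉ M ∧ ∃ g : H, IsGroupLikeElem k g ∧ ∀ f, ρ.op f m - f g • m ∈ M := by
  obtain ⟨n, hn, hnM⟩ := SetLike.not_le_iff_exists.1 hle
  -- The subcomodule generated by `n` is finite-dimensional.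
  let W : Submodule k N := Submodule.span k (Set.range fun f : Module.Dual k H => ρ.op f n)
  have hWfin : FiniteDimensional k W := by
    obtain ⟨W', _, hW'⟩ := exists_finiteDimensional_leftSlice_mem (ρ.coact n)
    refine Submodule.finiteDimensional_of_le (S₂ := W') (Submodule.span_le.2 ?_)
    rintro _ ⟨f, rfl⟩
    exact hW' f
  have hWN₀ : W ≤ N₀ := by
    refine Submodule.span_le.2 ?_
    rintro _ ⟨f, rfl⟩
    exact hN₀ f n hn
  have hWstab : ∀ f, ∀ w ∈ W, ρ.op f w ∈ W := by
    intro f w hw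
    refine Submodule.span_le (p := W.comap (ρ.op f)).2 ?_ hw
    rintro _ ⟨g, rfl⟩
    rw [SetLike.mem_coe, Submodule.mem_comap, op_op]
    exact Submodule.subset_span ⟨_, rfl⟩
  have hnW : n ∈ W := Submodule.subset_span ⟨counit, ρ.op_counit n⟩
  obtain ⟨m, hmW, hmM, hm⟩ := exists_eigenvector_of_finiteDimensional
    (fun f g n => ρ.op_comm g f n) hM W hWstab fun h => hnM (h hnW)
  refine ⟨m, hWN₀ hmW, hmM, ?_⟩
  obtain ⟨ν, hνM, hνm⟩ := LinearMap.exists_extend_of_notMem (0 : M →ₗ[k] k) hmM 1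
  replace hνM : ∀ x ∈ M, ν x = 0 := fun x hx => LinearMap.congr_fun hνM ⟨x, hx⟩
  -- The coaction on `m` modulo `M` is read off through a functional that is `1` at `m`.
  let g : H := TensorProduct.rid k H (ν.lTensor H (ρ.coact m))
  have hg : ∀ f, f g = ν (ρ.op f m) := by
    intro f
    rw [op_apply, ← leftSlice_lTensor]
    change f (TensorProduct.rid k H (ν.lTensor H (ρ.coact m))) = _
    generalize ν.lTensor H (ρ.coact m) = t
    induction t with
    | zero => simp
    | add s t hs ht => simp only [map_add, hs, ht]
    | tmul x y => simp [mul_comm]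
  have heig : ∀ f, ρ.op f m - f g • m ∈ M := by
    intro f
    obtain ⟨c, hc⟩ := hm f
    have h := hνM _ hc
    rw [map_sub, map_smul, hνm, ← hg, smul_eq_mul, mul_one, sub_eq_zero] at h
    rwa [h]
  refine ⟨g, ⟨?_, ?_⟩, heig⟩
  · rw [hg, op_counit, hνm]
  · rw [← sub_eq_zero]
    refine eq_zero_of_leftSlice_eq_zero fun f => ?_
    rw [← Module.forall_dual_apply_eq_zero_iff k]
    intro f'
    have h := hνM _ (hM f' _ (heig f))
    rw [map_sub, map_sub, map_smul, map_smul, op_op, ← hg, ← hg, smul_eq_mul] at h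
    rw [map_sub, map_sub, leftSlice_tmul, map_smul, smul_eq_mul]
    exact h

end LeftCoaction

/-! ### Hopf modules over a Hopf subalgebra -/

section HopfModule

variable {k : Type u} {A : Type v} {N : Type*} [Field k] [Ring A] [HopfAlgebra k A]
  [AddCommGroup N] [Module k N] (K : HopfSubalgebra k A) [Module K N] [IsScalarTower k K N]

/-- The augmentation ideal `K⁺` of a Hopf subalgebra `K`, as a left ideal of the ring `K`. -/
noncomputable def HopfSubalgebra.augmentationIdeal : Ideal K :=
  RingHom.ker (Bialgebra.counitAlgHom k K)

theorem HopfSubalgebra.mem_augmentationIdeal {z : K} :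
    z ∈ K.augmentationIdeal ↔ counit (R := k) (z : A) = 0 := Iff.rfl

namespace LeftCoaction

/-- The compatibility `ρ (z n) = z₍₁₎ n₍₋₁₎ ⊗ z₍₂₎ n₍₀₎` making an `A`-comodule with an action
of a Hopf subalgebra `K` of `A` a Hopf module, in terms of the operators `op f`. -/
def IsHopfModule (ρ : LeftCoaction k A N) : Prop :=
  ∀ (f : Module.Dual k A) (z : K) (r : Coalgebra.Repr k z (K × K)) (n : N), ρ.op f (z • n) =
    ∑ i ∈ r.index, r.right i • ρ.op (f ∘ₗ LinearMap.mulLeft k (r.left i : A)) n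

variable {K} {ρ : LeftCoaction k A N}

/-- Modulo a Hopf submodule, an eigenvector generates a free `K`-module: if `A` coacts on `m`
through the group-like `g`, then translating by `g⁻¹` shows that the annihilator of `m` is a coideal
of `K` contained in `K⁺`, hence zero. -/
theorem IsHopfModule.eq_zero_of_smul_mem (hρ : IsHopfModule K ρ) {M : Submodule K N}
    (hM : ρ.IsStable (M.restrictScalars k)) {m : N} (hmM : m ∉ M) {g : A}
    (hg : IsGroupLikeElem k g) (hm : ∀ f, ρ.op f m - f g • m ∈ M) {z : K} (hz : z • m ∈ M) :
    z = 0 := by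
  -- The annihilator is stable under contraction of the left leg of the comultiplication.
  have h1 : ∀ (f : Module.Dual k K) {z : K}, z • m ∈ M →
      leftSlice f (comul (R := k) z) • m ∈ M := by
    intro f z hz
    -- Extending `f` to `A` and translating it by `g⁻¹` cancels the factor `g` in the coaction.
    obtain ⟨f', hf'⟩ := LinearMap.exists_extend (p := Subalgebra.toSubmodule K.toSubalgebra) f
    let r := Coalgebra.Repr.arbitrary k z
    have h := hρ (f' ∘ₗ LinearMap.mulRight k (antipode k g)) z r m
    have h' : leftSlice f (comul (R := k) z) • m =
        ∑ i ∈ r.index, r.right i • f (r.left i) • m := by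
      rw [← r.eq, map_sum, Finset.sum_smul]
      refine Finset.sum_congr rfl fun i _ => ?_
      rw [leftSlice_tmul, smul_comm, smul_assoc]
    have hsub := M.sub_mem (hM (f' ∘ₗ LinearMap.mulRight k (antipode k g)) _ hz)
      (M.sum_mem (t := r.index) fun i _ => M.smul_mem (r.right i)
        (hm ((f' ∘ₗ LinearMap.mulRight k (antipode k g)) ∘ₗ LinearMap.mulLeft k (r.left i : A))))
    rw [h, ← Finset.sum_sub_distrib] at hsub
    rw [h']
    convert hsub using 2 with i
    rw [← smul_sub, sub_sub_cancel, ← hf']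
    simp only [LinearMap.comp_apply, LinearMap.mulLeft_apply, LinearMap.mulRight_apply, mul_assoc,
      hg.mul_antipode_cancel, mul_one]
    rfl
  let r : K →ₗ[k] N ⧸ M :=
    (M.mkQ.restrictScalars k) ∘ₗ (LinearMap.toSpanSingleton K N m).restrictScalars k
  have hr : ∀ y, r y = 0 ↔ y • m ∈ M := fun y => Submodule.Quotient.mk_eq_zero M
  -- As `z₍₂₎` may be taken in the annihilator, `ε z • m = S z₍₁₎ z₍₂₎ m` lies in `M`.
  have h2 : ∀ {z : K}, z • m ∈ M → counit (R := k) z = 0 := by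
    intro z hz
    have h3 : r.lTensor K (comul (R := k) z) = 0 := by
      refine eq_zero_of_leftSlice_eq_zero fun f => ?_
      rw [leftSlice_lTensor, hr]
      exact h1 f hz
    let e : K ⊗[k] (N ⧸ M) →ₗ[k] N ⧸ M := TensorProduct.lift
      ((Algebra.lsmul k k (N ⧸ M)).toLinearMap ∘ₗ antipode k)
    have h4 := congrArg e h3
    let R := Coalgebra.Repr.arbitrary k z
    have h5 : ∀ x y : K, e (x ⊗ₜ r y) = r (antipode k x * y) := fun x y =>
      (congrArg M.mkQ (mul_smul (antipode k x) y m)).symm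
    rw [← R.eq, map_sum, map_sum, map_zero] at h4
    simp only [LinearMap.lTensor_tmul, h5] at h4
    rw [← map_sum, sum_antipode_mul_eq_smul, map_smul, smul_eq_zero, hr, one_smul] at h4
    exact h4.resolve_right hmM
  rw [← Module.forall_dual_apply_eq_zero_iff k]
  intro f
  have h6 := h2 (h1 f hz)
  rwa [← leftSlice_lTensor, lTensor_counit_comul, leftSlice_tmul, smul_eq_mul, mul_one] at h6

variable [IsAlgClosed k] [IsCocomm k A]

/-- Passing to `N / K⁺N` is exact on Hopf modules: `N₀ ∩ K⁺N = K⁺N₀` for every Hopf submodule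
`N₀` of `N`. The Hopf submodules `M ⊇ N₀` with `N₀ ∩ K⁺M ⊆ K⁺N₀` have a maximal element by Zorn's
lemma; it is all of `N`, since a proper one could be enlarged by a free cyclic module. -/
theorem IsHopfModule.inf_smul_top_le (hρ : IsHopfModule K ρ) {N₀ : Submodule K N}
    (hN₀ : ρ.IsStable (N₀.restrictScalars k)) :
    N₀ ⊓ K.augmentationIdeal • (⊤ : Submodule K N) ≤ K.augmentationIdeal • N₀ := by
  let S : Set (Submodule K N) := {M | ρ.IsStable (M.restrictScalars k) ∧
    N₀ ⊓ K.augmentationIdeal • M ≤ K.augmentationIdeal • N₀}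
  obtain ⟨M, hle, ⟨hMS, hM⟩, hmax⟩ : ∃ M, N₀ ≤ M ∧ Maximal (· ∈ S) M := by
    refine zorn_le_nonempty₀ S ?_ N₀ ⟨hN₀, inf_le_right⟩
    intro c hcS hc M hMc
    refine ⟨sSup c, ⟨?_, ?_⟩, fun M hM => le_sSup hM⟩
    · intro f m hm
      obtain ⟨M', hM', hmM'⟩ := (Submodule.mem_sSup_of_directed ⟨M, hMc⟩ hc.directedOn).1 hm
      exact (le_sSup hM' : M' ≤ sSup c) ((hcS hM').1 f m hmM')
    · rintro n ⟨hn, hn'⟩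
      rw [sSup_eq_iSup', Submodule.smul_iSup] at hn'
      have : Nonempty c := ⟨⟨M, hMc⟩⟩
      rw [SetLike.mem_coe, Submodule.mem_iSup_of_directed] at hn'
      · obtain ⟨M', hM'⟩ := hn'
        exact (hcS M'.2).2 ⟨hn, hM'⟩
      · exact hc.directedOn.directed_val.mono_comp _ fun _ _ h => Submodule.smul_mono le_rfl h
  suffices M = ⊤ by rwa [← this]
  by_contra hne
  obtain ⟨m, -, hmM, g, hg, hm⟩ := ρ.exists_isGroupLikeElem (N₀ := ⊤)
    (fun _ _ _ => Submodule.mem_top) hMS fun h => hne (eq_top_iff.2 h)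
  refine hmM ((hmax (y := M ⊔ K ∙ m) ⟨?_, ?_⟩ le_sup_left : M ⊔ K ∙ m ≤ M)
    (Submodule.mem_sup_right (Submodule.mem_span_singleton_self m)))
  · intro f n hn
    obtain ⟨y, hy, w, hw, rfl⟩ := Submodule.mem_sup.1 hn
    obtain ⟨z, rfl⟩ := Submodule.mem_span_singleton.1 hw
    rw [map_add, hρ f z (Coalgebra.Repr.arbitrary k z) m]
    refine Submodule.add_mem _ (Submodule.mem_sup_left (hMS f y hy))
      ((M ⊔ K ∙ m).sum_mem fun i _ => (M ⊔ K ∙ m).smul_mem _ ?_)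
    rw [← sub_add_cancel (ρ.op _ m)]
    exact Submodule.add_mem_sup (hm _)
      (Submodule.smul_of_tower_mem _ _ (Submodule.mem_span_singleton_self m))
  · rintro n ⟨hn, hn'⟩
    rw [SetLike.mem_coe, Submodule.smul_sup] at hn'
    obtain ⟨y, hy, w, hw, rfl⟩ := Submodule.mem_sup.1 hn'
    obtain ⟨z, rfl⟩ := Submodule.mem_span_singleton.1 (Submodule.smul_le_right hw)
    have hz : z • m ∈ M := by
      rw [← add_sub_cancel_left y (z • m)]
      exact M.sub_mem (hle hn) (Submodule.smul_le_right hy)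
    have hz0 := hρ.eq_zero_of_smul_mem hMS hmM hg hm hz
    rw [hz0, zero_smul, add_zero] at hn ⊢
    exact hM ⟨hn, hy⟩

end LeftCoaction

end HopfModule

/-- For a morphism `G : N → N'` of Hopf modules, every element of the kernel of the induced map
`N / K⁺N → N' / K⁺N'` lifts to the kernel of `G`. -/
theorem LeftCoaction.IsHopfModule.exists_sub_mem_smul_top {k : Type u} {A : Type v} {N N' : Type*}
    [Field k] [IsAlgClosed k] [Ring A] [HopfAlgebra k A] [IsCocomm k A] {K : HopfSubalgebra k A}
    [AddCommGroup N] [Module k N] [Module K N] [AddCommGroup N'] [Module k N'] [Module K N']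
    [IsScalarTower k K N'] {ρ : LeftCoaction k A N} {ρ' : LeftCoaction k A N'}
    (hρ' : IsHopfModule K ρ')
    (G : N →ₗ[K] N') (hG : ∀ f n, G (ρ.op f n) = ρ'.op f (G n)) {n : N}
    (hn : G n ∈ K.augmentationIdeal • (⊤ : Submodule K N')) :
    ∃ n', G n' = 0 ∧ n - n' ∈ K.augmentationIdeal • (⊤ : Submodule K N) := by
  have hstab : ρ'.IsStable ((LinearMap.range G).restrictScalars k) := by
    rintro f _ ⟨x, rfl⟩
    exact ⟨ρ.op f x, hG f x⟩
  have h := hρ'.inf_smul_top_le hstab ⟨⟨n, rfl⟩, hn⟩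
  rw [LinearMap.range_eq_map, ← Submodule.map_smul''] at h
  obtain ⟨w, hw, hwn⟩ := h
  refine ⟨n - w, by rw [map_sub, hwn, sub_self], ?_⟩
  rwa [sub_sub_cancel]

/-! ### Regular and cofree comodules -/

theorem leftSlice_counit_comul {k A : Type*} [Field k] [AddCommGroup A] [Module k A]
    [Coalgebra k A] (a : A) :
    leftSlice (counit (R := k)) (comul (R := k) a) = a := by
  change TensorProduct.lid k A ((counit (R := k)).rTensor A (comul (R := k) a)) = a
  rw [rTensor_counit_comul, TensorProduct.lid_tmul, one_smul]

namespace LeftCoaction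

section Cofree

variable {k : Type u} {A B : Type v} [Field k] [Ring A] [HopfAlgebra k A] [Ring B]
  [HopfAlgebra k B] {V W : Type*} [AddCommGroup V] [Module k V] [AddCommGroup W] [Module k W]

variable (k A) in
/-- The coaction of `A` on itself by comultiplication. -/
noncomputable def regular : LeftCoaction k A A where
  coact := comul
  coassoc := coassoc_apply
  counit_coact := leftSlice_counit_comul

variable (k A V) in
/-- The cofree comodule `A ⊗ V`, with `A` coacting on the left tensor factor. -/
noncomputable def cofree : LeftCoaction k A (A ⊗[k] V) where
  coact := (TensorProduct.assoc k A A V).toLinearMap ∘ₗ (comul (R := k)).rTensor V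
  coassoc n := by
    induction n with
    | zero => simp
    | add s t hs ht => simp only [map_add, hs, ht]
    | tmul a v =>
      let F : A ⊗[k] (A ⊗[k] A) →ₗ[k] A ⊗[k] (A ⊗[k] (A ⊗[k] V)) :=
        (TensorProduct.assoc k A A V).toLinearMap.lTensor A ∘ₗ
          (TensorProduct.assoc k A (A ⊗[k] A) V).toLinearMap ∘ₗ (TensorProduct.mk k _ V).flip v
      have h1 : ∀ z : A ⊗[k] A, TensorProduct.assoc k A A (A ⊗[k] V)
          ((comul (R := k)).rTensor (A ⊗[k] V) (TensorProduct.assoc k A A V (z ⊗ₜ v))) =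
          F (TensorProduct.assoc k A A A ((comul (R := k)).rTensor A z)) := by
        intro z
        induction z with
        | zero => simp
        | add s t hs ht => simp only [map_add, TensorProduct.add_tmul, hs, ht]
        | tmul x y =>
          simp only [TensorProduct.assoc_tmul, LinearMap.rTensor_tmul]
          generalize comul (R := k) x = w
          induction w with
          | zero => simp
          | add s t hs ht => simp only [map_add, TensorProduct.add_tmul, hs, ht]
          | tmul => rfl
      have h2 : ∀ z : A ⊗[k] A, ((TensorProduct.assoc k A A V).toLinearMap ∘ₗ
          (comul (R := k)).rTensor V).lTensor A (TensorProduct.assoc k A A V (z ⊗ₜ v)) =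
          F ((comul (R := k)).lTensor A z) := by
        intro z
        induction z with
        | zero => simp
        | add s t hs ht => simp only [map_add, TensorProduct.add_tmul, hs, ht]
        | tmul => rfl
      rw [LinearMap.comp_apply, LinearMap.rTensor_tmul, LinearEquiv.coe_coe, h1, h2,
        coassoc_apply]
  counit_coact n := by
    induction n with
    | zero => simp
    | add s t hs ht => simp only [map_add, hs, ht]
    | tmul a v =>
      conv_rhs => rw [← leftSlice_counit_comul (k := k) a]
      rw [LinearMap.comp_apply, LinearMap.rTensor_tmul]
      generalize comul (R := k) a = z
      induction z with
      | zero => simp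
      | add s t hs ht => simp only [map_add, TensorProduct.add_tmul, hs, ht]
      | tmul x y => simp [TensorProduct.smul_tmul']

/-- The map `a ↦ p a₍₁₎ ⊗ a₍₂₎` makes `A` a left `B`-comodule. -/
noncomputable def ofBialgHom (p : A →ₐc[k] B) : LeftCoaction k B A where
  coact := (HopfSubalgebra.coaction p).toLinearMap
  coassoc a := by
    let q : A →ₗ[k] B := p.toCoalgHom.toLinearMap
    have h1 : ∀ t : A ⊗[k] A, TensorProduct.assoc k B B A
        ((comul (R := k)).rTensor A (TensorProduct.map q LinearMap.id t)) =
        TensorProduct.map q (TensorProduct.map q LinearMap.id)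
          (TensorProduct.assoc k A A A ((comul (R := k)).rTensor A t)) := by
      intro t
      induction t with
      | zero => simp
      | add s t hs ht => simp only [map_add, hs, ht]
      | tmul x y =>
        have h : comul (R := k) (q x) = TensorProduct.map q q (comul (R := k) x) :=
          (CoalgHomClass.map_comp_comul_apply p x).symm
        simp only [TensorProduct.map_tmul, LinearMap.rTensor_tmul, h]
        generalize comul (R := k) x = w
        induction w with
        | zero => simp
        | add s t hs ht => simp only [map_add, TensorProduct.add_tmul, hs, ht]
        | tmul => rfl
    have h2 : ∀ t : A ⊗[k] A, (HopfSubalgebra.coaction p).toLinearMap.lTensor B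
        (TensorProduct.map q LinearMap.id t) =
        TensorProduct.map q (TensorProduct.map q LinearMap.id)
          ((comul (R := k)).lTensor A t) := by
      intro t
      induction t with
      | zero => simp
      | add s t hs ht => simp only [map_add, hs, ht]
      | tmul => rfl
    exact (h1 _).trans ((congrArg _ (coassoc_apply a)).trans (h2 _).symm)
  counit_coact a := by
    change TensorProduct.lid k A (TensorProduct.map (counit (R := k)) LinearMap.id
      (HopfSubalgebra.coaction p a)) = a
    rw [HopfSubalgebra.counit_coaction, TensorProduct.lid_tmul, one_smul]

theorem op_cofree_tmul (f : Module.Dual k A) (a : A) (v : V) :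
    (cofree k A V).op f (a ⊗ₜ v) = (regular k A).op f a ⊗ₜ v := by
  change leftSlice f (TensorProduct.assoc k A A V (comul (R := k) a ⊗ₜ v)) =
    leftSlice f (comul (R := k) a) ⊗ₜ v
  generalize comul (R := k) a = z
  induction z with
  | zero => simp
  | add s t hs ht => simp only [map_add, TensorProduct.add_tmul, hs, ht]
  | tmul x y => simp [TensorProduct.smul_tmul']

theorem isHopfModule_regular (K : HopfSubalgebra k A) : IsHopfModule K (regular k A) := by
  intro f z r n
  have h : comul (R := k) (z : A) = ∑ i ∈ r.index, (r.left i : A) ⊗ₜ[k] (r.right i : A) := by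
    rw [← K.map_comul, ← r.eq, map_sum]
    rfl
  change leftSlice f (comul (R := k) ((z : A) * n)) =
    ∑ i ∈ r.index, (r.right i : A) * leftSlice _ (comul (R := k) n)
  rw [Bialgebra.comul_mul, h, Finset.sum_mul, map_sum]
  refine Finset.sum_congr rfl fun i _ => ?_
  generalize comul (R := k) n = w
  induction w with
  | zero => simp
  | add s t hs ht => simp only [map_add, mul_add, hs, ht]
  | tmul x y => simp

theorem isHopfModule_cofree (K : HopfSubalgebra k A) : IsHopfModule K (cofree k A V) := by
  intro f z r n
  induction n with
  | zero => simp
  | add s t hs ht => simp only [smul_add, map_add, hs, ht, Finset.sum_add_distrib]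
  | tmul a v =>
    have hsmul : ∀ (y : K) (b : A), y • b ⊗ₜ[k] v = (y • b) ⊗ₜ[k] v := fun _ _ => rfl
    rw [hsmul, op_cofree_tmul, isHopfModule_regular K f z r a, TensorProduct.sum_tmul]
    refine Finset.sum_congr rfl fun i _ => ?_
    rw [op_cofree_tmul, hsmul]

/-- The map `a ↦ a₍₁₎ ⊗ ψ a₍₂₎` is a comodule morphism from `A` to the cofree comodule. -/
theorem op_cofree_lTensor_comul (ψ : A →ₗ[k] V) (f : Module.Dual k A) (a : A) :
    (cofree k A V).op f (ψ.lTensor A (comul (R := k) a)) =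
      ψ.lTensor A (comul (R := k) ((regular k A).op f a)) := by
  have h1 : ∀ t : A ⊗[k] A, (cofree k A V).op f (ψ.lTensor A t) =
      ψ.lTensor A ((cofree k A A).op f t) := by
    intro t
    induction t with
    | zero => simp
    | add s t hs ht => simp only [map_add, hs, ht]
    | tmul x y => simp [op_cofree_tmul]
  rw [h1]
  congr 1
  change leftSlice f (TensorProduct.assoc k A A A
    ((comul (R := k)).rTensor A (comul (R := k) a))) = _
  rw [coassoc_apply, leftSlice_lTensor]
  rfl

end Cofree

end LeftCoaction

/-! ### The Hopf kernel -/

open LeftCoaction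

section HopfKernel

variable {k : Type u} {A B : Type v} [Field k] [Ring A] [HopfAlgebra k A] [Ring B]
  [HopfAlgebra k B] {V : Type*} [AddCommGroup V] [Module k V]

variable (k B) in
/-- The trivial Hopf subalgebra `k · 1`. -/
def HopfSubalgebra.trivial : HopfSubalgebra k B where
  toSubalgebra := ⊥
  comul_mem' := by
    intro x hx
    obtain ⟨c, rfl⟩ := Algebra.mem_bot.1 hx
    refine ⟨c • (1 ⊗ₜ 1), ?_⟩
    rw [Bialgebra.comul_algebraMap, map_smul, Algebra.algebraMap_eq_smul_one]
    rfl
  antipode_mem' := by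
    intro x hx
    obtain ⟨c, rfl⟩ := Algebra.mem_bot.1 hx
    rw [Algebra.algebraMap_eq_smul_one, map_smul, antipode_one]
    exact Subalgebra.smul_mem _ (one_mem _) c

/-- The Hopf kernel `{x | p x₍₁₎ ⊗ x₍₂₎ = 1 ⊗ x}`, as the h-inverse of the trivial Hopf
subalgebra. -/
noncomputable def hopfKernel [IsCocomm k A] (p : A →ₐc[k] B) : HopfSubalgebra k A :=
  HopfSubalgebra.hInverse p (HopfSubalgebra.trivial k B)

/-- The right coaction `x ↦ x₍₁₎ ⊗ p x₍₂₎`, as an algebra morphism. -/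
noncomputable def rightCoaction (p : A →ₐc[k] B) : A →ₐ[k] A ⊗[k] B :=
  (Algebra.TensorProduct.map (AlgHom.id k A) (AlgHomClass.toAlgHom p)).comp
    (Bialgebra.comulAlgHom k A)

theorem rightCoaction_apply (p : A →ₐc[k] B) (x : A) :
    rightCoaction p x = p.toCoalgHom.toLinearMap.lTensor A (comul (R := k) x) := rfl

theorem comm_coaction [IsCocomm k A] (p : A →ₐc[k] B) (x : A) :
    TensorProduct.comm k B A (HopfSubalgebra.coaction p x) = rightCoaction p x := by
  rw [rightCoaction_apply, ← comm_comul k x, HopfSubalgebra.coaction_apply, LinearMap.lTensor,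
    TensorProduct.map_comm]

theorem mem_hopfKernel_iff [IsCocomm k A] (p : A →ₐc[k] B) (x : A) :
    x ∈ (hopfKernel p).toSubalgebra ↔ HopfSubalgebra.coaction p x = 1 ⊗ₜ x := by
  change x ∈ ((hopfKernel p).toSubalgebra : Set A) ↔ _
  rw [hopfKernel, HopfSubalgebra.coe_hInverse, ← HopfSubalgebra.coe_hInverseSubalgebra,
    SetLike.mem_coe, HopfSubalgebra.mem_hInverseSubalgebra]
  constructor
  · rintro ⟨t, ht⟩
    have h : ∀ t : HopfSubalgebra.trivial k B ⊗[k] A,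
        TensorProduct.map (HopfSubalgebra.trivial k B).incl LinearMap.id t =
          1 ⊗ₜ leftSlice (counit (R := k))
            (TensorProduct.map (HopfSubalgebra.trivial k B).incl LinearMap.id t) := by
      intro t
      induction t with
      | zero => simp
      | add s t hs ht => rw [map_add, map_add, TensorProduct.tmul_add, ← hs, ← ht]
      | tmul c a =>
        obtain ⟨c, hc⟩ := c
        obtain ⟨r, rfl⟩ := Algebra.mem_bot.1 hc
        simp [TensorProduct.smul_tmul, Algebra.algebraMap_eq_smul_one]
    have h1 := h t
    rw [ht] at h1
    rw [h1]
    congr 1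
    exact (ofBialgHom p).counit_coact x
  · intro h
    exact ⟨1 ⊗ₜ x, h.symm⟩

theorem mem_hopfKernel_iff' [IsCocomm k A] (p : A →ₐc[k] B) (x : A) :
    x ∈ (hopfKernel p).toSubalgebra ↔ rightCoaction p x = x ⊗ₜ 1 := by
  rw [mem_hopfKernel_iff, ← comm_coaction, ← (TensorProduct.comm k B A).injective.eq_iff,
    TensorProduct.comm_tmul]

theorem map_of_mem_hopfKernel [IsCocomm k A] (p : A →ₐc[k] B) {x : A}
    (hx : x ∈ (hopfKernel p).toSubalgebra) : p x = algebraMap k B (counit (R := k) x) := by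
  have h := congrArg (leftSlice (counit (R := k))) ((mem_hopfKernel_iff' p x).1 hx)
  rw [rightCoaction_apply, leftSlice_lTensor, leftSlice_counit_comul, leftSlice_tmul] at h
  rw [Algebra.algebraMap_eq_smul_one, ← h]
  rfl

theorem rightCoaction_smul [IsCocomm k A] (p : A →ₐc[k] B) (z : hopfKernel p) (a : A) :
    rightCoaction p (z • a) = z • rightCoaction p a := by
  change rightCoaction p ((z : A) * a) = (z : A) • rightCoaction p a
  rw [map_mul, (mem_hopfKernel_iff' p z).1 z.2]
  generalize rightCoaction p a = t
  induction t with
  | zero => simp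
  | add s t hs ht => rw [mul_add, smul_add, hs, ht]
  | tmul x y => rw [Algebra.TensorProduct.tmul_mul_tmul, one_mul]; rfl

/-- `a ↦ a₍₁₎ ⊗ ψ (p a₍₂₎)` as a morphism of modules over the Hopf kernel of `p`. -/
noncomputable def hopfKernelHom [IsCocomm k A] (p : A →ₐc[k] B) (ψ : B →ₗ[k] V) :
    A →ₗ[hopfKernel p] A ⊗[k] V where
  toFun a := ψ.lTensor A (rightCoaction p a)
  map_add' a b := by rw [map_add, map_add]
  map_smul' z a := by
    rw [rightCoaction_smul]
    change ψ.lTensor A ((z : A) • rightCoaction p a) = (z : A) • _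
    generalize rightCoaction p a = t
    induction t with
    | zero => simp
    | add s t hs ht => simp only [smul_add, map_add, hs, ht]
    | tmul x y => rfl

theorem hopfKernelHom_op [IsCocomm k A] (p : A →ₐc[k] B) (ψ : B →ₗ[k] V) (f : Module.Dual k A)
    (a : A) : hopfKernelHom p ψ ((regular k A).op f a) =
      (cofree k A V).op f (hopfKernelHom p ψ a) := by
  have h : ∀ a, hopfKernelHom p ψ a =
      (ψ ∘ₗ p.toCoalgHom.toLinearMap).lTensor A (comul (R := k) a) := fun a => by
    rw [LinearMap.lTensor_comp]; rfl
  rw [h, h, op_cofree_lTensor_comul]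

/-- If the kernel of `q` lies in `K⁺A`, then the kernel of `q ⊗ V` lies in `K⁺(A ⊗ V)`. -/
theorem mem_smul_top_of_rTensor_eq_zero (K : HopfSubalgebra k A) {X : Type*} [AddCommGroup X]
    [Module k X] (q : A →ₗ[k] X)
    (hq : ∀ a, q a = 0 → a ∈ K.augmentationIdeal • (⊤ : Submodule K A)) {t : A ⊗[k] V}
    (ht : q.rTensor V t = 0) : t ∈ K.augmentationIdeal • (⊤ : Submodule K (A ⊗[k] V)) := by
  have hex : Function.Exact (LinearMap.ker q).subtype q := fun a =>
    ⟨fun h => ⟨⟨a, h⟩, rfl⟩, fun ⟨z, hz⟩ => hz ▸ z.2⟩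
  obtain ⟨w, rfl⟩ := (Module.Flat.rTensor_exact V hex t).1 ht
  clear ht
  induction w with
  | zero => rw [map_zero]; exact Submodule.zero_mem _
  | add s t hs ht => rw [map_add]; exact Submodule.add_mem _ hs ht
  | tmul a v =>
    obtain ⟨a, ha⟩ := a
    refine Submodule.smul_induction_on (p := fun a => a ⊗ₜ[k] v ∈
      K.augmentationIdeal • (⊤ : Submodule K (A ⊗[k] V))) (hq a ha) ?_ ?_
    · exact fun z hz b _ => Submodule.smul_mem_smul (n := b ⊗ₜ[k] v) hz Submodule.mem_top
    · intro x y hx hy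
      rw [TensorProduct.add_tmul]
      exact Submodule.add_mem _ hx hy

theorem lTensor_coaction (p : A →ₐc[k] B) (a : A) :
    p.toCoalgHom.toLinearMap.lTensor B (HopfSubalgebra.coaction p a) =
      comul (R := k) (p a) := by
  rw [HopfSubalgebra.coaction_apply, LinearMap.lTensor, ← LinearMap.comp_apply,
    ← TensorProduct.map_comp]
  exact CoalgHomClass.map_comp_comul_apply p a

theorem isStable_ker (p : A →ₐc[k] B) :
    (ofBialgHom p).IsStable (LinearMap.ker p.toCoalgHom.toLinearMap) := by
  intro f a ha
  change p.toCoalgHom.toLinearMap (leftSlice f (HopfSubalgebra.coaction p a)) = 0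
  have ha' : p a = 0 := ha
  rw [← leftSlice_lTensor, lTensor_coaction, ha', map_zero, map_zero]

variable [IsCocomm k A]

theorem map_eq_zero_of_mem_smul_top (p : A →ₐc[k] B) {x : A}
    (hx : x ∈ (hopfKernel p).augmentationIdeal • (⊤ : Submodule (hopfKernel p) A)) : p x = 0 := by
  refine Submodule.smul_induction_on (p := fun x => p x = 0) hx ?_ ?_
  · intro z hz a _
    change p ((z : A) * a) = 0
    rw [map_mul, map_of_mem_hopfKernel p z.2, (hopfKernel p).mem_augmentationIdeal.1 hz, map_zero,
      zero_mul]
  · intro x y hx hy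
    rw [map_add, hx, hy, add_zero]

/-- If some `y ≠ 0` in `A` satisfies `y₍₁₎ ⊗ p y₍₂₎ = y ⊗ h`, then `h` lifts to a group-like element
of `A`: the space of all such `y` is a subcomodule of `A`, and an eigenvector in it is a multiple of
a group-like element. -/
theorem exists_isGroupLikeElem_map_eq [IsAlgClosed k] (p : A →ₐc[k] B) {h : B} {y : A} (hy : y ≠ 0)
    (hyh : rightCoaction p y = y ⊗ₜ h) : ∃ g : A, IsGroupLikeElem k g ∧ p g = h := by
  let N : Submodule k A :=
    LinearMap.ker ((rightCoaction p).toLinearMap - (TensorProduct.mk k A B).flip h)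
  have hN : ∀ a, a ∈ N ↔ rightCoaction p a = a ⊗ₜ h := fun a => sub_eq_zero
  obtain ⟨m, hmN, hm0, g, hg, hm⟩ := (regular k A).exists_isGroupLikeElem (N₀ := N) (M := ⊥)
    (fun f a ha => by
      rw [hN] at ha ⊢
      rw [rightCoaction_apply, ← op_cofree_lTensor_comul, ← rightCoaction_apply, ha,
        op_cofree_tmul])
    (fun _ m hm => by rw [(Submodule.mem_bot k).1 hm, map_zero]; exact Submodule.zero_mem _)
    (fun hle => hy ((Submodule.mem_bot k).1 (hle ((hN y).2 hyh))))
  have hm1 : comul (R := k) m = g ⊗ₜ m := by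
    rw [← sub_eq_zero]
    refine eq_zero_of_leftSlice_eq_zero fun f => ?_
    rw [map_sub, leftSlice_tmul]
    exact (Submodule.mem_bot k).1 (hm f)
  have hm2 : m = counit (R := k) m • g := by
    have := congrArg (fun t => TensorProduct.rid k A ((counit (R := k)).lTensor A t)) hm1
    simpa using this
  refine ⟨g, hg, ?_⟩
  have hm3 := congrArg (leftSlice (counit (R := k))) ((hN m).1 hmN)
  rw [rightCoaction_apply, leftSlice_lTensor, leftSlice_counit_comul, leftSlice_tmul] at hm3
  have hm4 : counit (R := k) m • p g = counit (R := k) m • h := by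
    rw [← map_smul, ← hm2]
    exact hm3
  exact smul_right_injective B
    (fun h0 => hm0 (by rw [hm2, h0, zero_smul]; exact Submodule.zero_mem _)) hm4

/-- As `p z₍₁₎ ⊗ z₍₂₎ = 1 ⊗ z` on the Hopf kernel, the functionals on `B` act linearly over it. -/
theorem op_ofBialgHom_smul (p : A →ₐc[k] B) (f : Module.Dual k B) (z : hopfKernel p) (a : A) :
    (ofBialgHom p).op f (z • a) = z • (ofBialgHom p).op f a := by
  change leftSlice f (HopfSubalgebra.coaction p ((z : A) * a)) =
    (z : A) * leftSlice f (HopfSubalgebra.coaction p a)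
  rw [map_mul, (mem_hopfKernel_iff p z).1 z.2]
  generalize HopfSubalgebra.coaction p a = t
  induction t with
  | zero => simp
  | add s t hs ht => simp only [mul_add, map_add, hs, ht]
  | tmul x y => simp

theorem isStable_augmentationIdeal_smul_top (p : A →ₐc[k] B) :
    (ofBialgHom p).IsStable (((hopfKernel p).augmentationIdeal •
      (⊤ : Submodule (hopfKernel p) A)).restrictScalars k) := by
  intro f a ha
  let T : A →ₗ[hopfKernel p] A :=
    { toFun := (ofBialgHom p).op f
      map_add' := map_add _
      map_smul' := op_ofBialgHom_smul p f }
  have hle : (hopfKernel p).augmentationIdeal • (⊤ : Submodule (hopfKernel p) A) ≤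
      ((hopfKernel p).augmentationIdeal • (⊤ : Submodule (hopfKernel p) A)).comap T :=
    Submodule.smul_le.2 fun z hz b _ => by
      rw [Submodule.mem_comap, map_smul]
      exact Submodule.smul_mem_smul hz Submodule.mem_top
  exact hle ha

theorem rTensor_mkQ_rightCoaction_sub (p : A →ₐc[k] B) {M : Submodule k A} {y : A} {h : B}
    (hy : ∀ f, (ofBialgHom p).op f y - f h • y ∈ M) :
    M.mkQ.rTensor B (rightCoaction p y - y ⊗ₜ h) = 0 := by
  have hcomm : ∀ t : B ⊗[k] A, M.mkQ.rTensor B (TensorProduct.comm k B A t) =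
      TensorProduct.comm k B (A ⧸ M) (M.mkQ.lTensor B t) := fun t =>
    TensorProduct.map_comm ..
  rw [← comm_coaction, ← TensorProduct.comm_tmul, ← map_sub, hcomm,
    LinearEquiv.map_eq_zero_iff]
  refine eq_zero_of_leftSlice_eq_zero fun f => ?_
  rw [leftSlice_lTensor, map_sub, leftSlice_tmul]
  exact (Submodule.Quotient.mk_eq_zero M).2 (hy f)

/-- The map `a ↦ a₍₁₎ ⊗ p a₍₂₎ - a ⊗ h`, whose kernel consists of the elements of `A` lying over
`h`, as a morphism of modules over the Hopf kernel of `p`. -/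
noncomputable def fiberHom (p : A →ₐc[k] B) (h : B) : A →ₗ[hopfKernel p] A ⊗[k] B where
  toFun a := rightCoaction p a - a ⊗ₜ h
  map_add' a b := by rw [map_add, TensorProduct.add_tmul, add_sub_add_comm]
  map_smul' z a := by rw [rightCoaction_smul, RingHom.id_apply, smul_sub]; rfl

theorem fiberHom_apply (p : A →ₐc[k] B) (h : B) (a : A) :
    fiberHom p h a = rightCoaction p a - a ⊗ₜ h := rfl

theorem fiberHom_op (p : A →ₐc[k] B) (h : B) (f : Module.Dual k A) (a : A) :
    fiberHom p h ((regular k A).op f a) = (cofree k A B).op f (fiberHom p h a) := by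
  rw [fiberHom_apply, fiberHom_apply, map_sub, op_cofree_tmul, rightCoaction_apply,
    rightCoaction_apply, op_cofree_lTensor_comul]

/-- An element of `ker p` lying over the image of a group-like element `g` is in `K⁺A`: translating
by `g⁻¹` moves it into `K⁺`. -/
theorem mem_smul_top_of_rightCoaction_eq (p : A →ₐc[k] B) {g : A} (hg : IsGroupLikeElem k g) {y : A}
    (hy : rightCoaction p y = y ⊗ₜ p g) (hpy : p y = 0) :
    y ∈ (hopfKernel p).augmentationIdeal • (⊤ : Submodule (hopfKernel p) A) := by
  have hxK : y * antipode k g ∈ (hopfKernel p).toSubalgebra := by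
    rw [mem_hopfKernel_iff', map_mul, hy, rightCoaction_apply, hg.antipode.comul_eq_tmul_self,
      LinearMap.lTensor_tmul, Algebra.TensorProduct.tmul_mul_tmul]
    congr 1
    change p g * p (antipode k g) = 1
    rw [← map_mul, hg.mul_antipode_cancel, map_one]
  have hmem : (⟨_, hxK⟩ : hopfKernel p) ∈ (hopfKernel p).augmentationIdeal := by
    rw [HopfSubalgebra.mem_augmentationIdeal]
    change counit (R := k) (y * antipode k g) = 0
    rw [Bialgebra.counit_mul, ← CoalgHomClass.counit_comp_apply p y, hpy, map_zero, zero_mul]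
  have hprod : (⟨_, hxK⟩ : hopfKernel p) • g = y := by
    change y * antipode k g * g = y
    rw [mul_assoc, hg.antipode_mul_cancel, mul_one]
  have h := Submodule.smul_mem_smul hmem (Submodule.mem_top (x := g))
  rwa [hprod] at h

/-- Newman's theorem over an algebraically closed field: the kernel of a morphism of cocommutative
Hopf algebras is generated by the augmentation ideal `K⁺` of its Hopf kernel. Otherwise `ker p / K⁺A`
contains an eigenvector, on which `B` coacts through a group-like element `h`; lifting it to an
element of `A` lying over `h` contradicts `mem_smul_top_of_rightCoaction_eq`. -/
theorem mem_smul_top_of_map_eq_zero [IsAlgClosed k] [IsCocomm k B] (p : A →ₐc[k] B) {x : A}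
    (hx : p x = 0) :
    x ∈ (hopfKernel p).augmentationIdeal • (⊤ : Submodule (hopfKernel p) A) := by
  by_contra hxJ₀
  obtain ⟨y, hyJ, hyJ₀, h, -, hy⟩ := (ofBialgHom p).exists_isGroupLikeElem (isStable_ker p)
    (isStable_augmentationIdeal_smul_top p) (fun hle => hxJ₀ (hle hx))
  have h0 : fiberHom p h y ∈
      (hopfKernel p).augmentationIdeal • (⊤ : Submodule (hopfKernel p) (A ⊗[k] B)) :=
    mem_smul_top_of_rTensor_eq_zero (hopfKernel p) _
      (fun a ha => (Submodule.Quotient.mk_eq_zero _).1 ha) (rTensor_mkQ_rightCoaction_sub p hy)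
  have h0' := (isHopfModule_cofree (hopfKernel p)).exists_sub_mem_smul_top
    (fiberHom p h) (fiberHom_op p h) h0
  obtain ⟨y', hy', hyy'⟩ := h0'
  rw [fiberHom_apply, sub_eq_zero] at hy'
  have hy'J₀ : y' ∉ (hopfKernel p).augmentationIdeal • (⊤ : Submodule (hopfKernel p) A) :=
    fun h => hyJ₀ (by
      rw [← sub_add_cancel y y']
      exact Submodule.add_mem ((hopfKernel p).augmentationIdeal • ⊤) hyy' h)
  obtain ⟨g, hg, rfl⟩ := exists_isGroupLikeElem_map_eq p
    (fun h => hy'J₀ (by rw [h]; exact Submodule.zero_mem _)) hy'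
  refine hy'J₀ (mem_smul_top_of_rightCoaction_eq p hg hy' ?_)
  have h1 : p y = 0 := hyJ
  have h2 := map_eq_zero_of_mem_smul_top p hyy'
  rwa [map_sub, h1, zero_sub, neg_eq_zero] at h2

/-- Exactness of the cotensor product, over an algebraically closed field: the morphism of Hopf
modules `a ↦ a₍₁₎ ⊗ ψ (p a₍₂₎)` from `A` to `A ⊗ V` reduces, modulo `K⁺`, to the map
`b ↦ b₍₁₎ ⊗ ψ b₍₂₎` from `B` to `B ⊗ V`, and elements of the kernel of the latter lift. -/
theorem exists_lTensor_comul_eq_zero_of_isAlgClosed [IsAlgClosed k] [IsCocomm k B] (p : A →ₐc[k] B)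
    (hp : Function.Surjective p) (ψ : B →ₗ[k] V) {c : B}
    (hc : ψ.lTensor B (comul (R := k) c) = 0) :
    ∃ x : A, ψ.lTensor A (rightCoaction p x) = 0 ∧ p x = c := by
  obtain ⟨a, rfl⟩ := hp c
  have h0 : hopfKernelHom p ψ a ∈
      (hopfKernel p).augmentationIdeal • (⊤ : Submodule (hopfKernel p) (A ⊗[k] V)) :=
    mem_smul_top_of_rTensor_eq_zero _ p.toCoalgHom.toLinearMap
      (fun _ => mem_smul_top_of_map_eq_zero p) (by
        change p.toCoalgHom.toLinearMap.rTensor V (ψ.lTensor A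
          (p.toCoalgHom.toLinearMap.lTensor A (comul (R := k) a))) = 0
        have h := congrArg (ψ.lTensor B) (CoalgHomClass.map_comp_comul_apply p a)
        rw [hc] at h
        rw [← h]
        generalize comul (R := k) a = t
        induction t with
        | zero => simp
        | add s t hs ht => simp only [map_add, hs, ht]
        | tmul x y => rfl)
  obtain ⟨x, hx, hax⟩ := (isHopfModule_cofree (hopfKernel p)).exists_sub_mem_smul_top
    (hopfKernelHom p ψ) (hopfKernelHom_op p ψ) h0
  refine ⟨x, hx, ?_⟩
  have := map_eq_zero_of_mem_smul_top p hax
  rw [map_sub, sub_eq_zero] at this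
  exact this.symm

end HopfKernel

/-! ### Descent from the algebraic closure -/

section BaseChange

variable {k : Type u} {A B : Type v} [Field k] [Ring A] [HopfAlgebra k A] [Ring B]
  [HopfAlgebra k B] {V : Type*} [AddCommGroup V] [Module k V] (L : Type u) [Field L] [Algebra k L]

theorem lTensor_baseChange_comul (ψ : A →ₗ[k] V) (l : L) (a : A) :
    (ψ.baseChange L).lTensor (L ⊗[k] A) (comul (R := L) (l ⊗ₜ[k] a)) =
      TensorProduct.AlgebraTensorModule.distribBaseChange k L A V
        (l ⊗ₜ ψ.lTensor A (comul (R := k) a)) := by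
  rw [TensorProduct.comul_tmul, CommSemiring.comul_apply]
  generalize comul (R := k) a = t
  induction t with
  | zero => simp
  | add s t hs ht => simp only [map_add, TensorProduct.tmul_add, hs, ht]
  | tmul x y =>
    apply (TensorProduct.AlgebraTensorModule.distribBaseChange k L A V).symm.injective
    simp

/-- The base change of a morphism of Hopf algebras. -/
noncomputable def BialgHom.baseChange (p : A →ₐc[k] B) : L ⊗[k] A →ₐc[L] L ⊗[k] B :=
  Bialgebra.TensorProduct.map (BialgHom.id L L) p

/-- Exactness of the cotensor product over an arbitrary field. The hypotheses pass to the algebraic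
closure, and the lift found there is mapped back by a linear retraction onto the base field. -/
theorem exists_lTensor_rightCoaction_eq_zero [IsCocomm k A] [IsCocomm k B] (p : A →ₐc[k] B)
    (hp : Function.Surjective p) (ψ : B →ₗ[k] V) {c : B}
    (hc : ψ.lTensor B (comul (R := k) c) = 0) :
    ∃ x : A, ψ.lTensor A (rightCoaction p x) = 0 ∧ p x = c := by
  let L := AlgebraicClosure k
  let D := TensorProduct.AlgebraTensorModule.distribBaseChange k L A V
  have hpL : ∀ x, BialgHom.baseChange L p x = p.toCoalgHom.toLinearMap.lTensor L x := fun x => rfl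
  obtain ⟨x, hx, hpx⟩ := exists_lTensor_comul_eq_zero_of_isAlgClosed (BialgHom.baseChange L p)
    (fun y => LinearMap.lTensor_surjective L (g := p.toCoalgHom.toLinearMap) hp y)
    (ψ.baseChange L) (c := 1 ⊗ₜ c)
    (by rw [lTensor_baseChange_comul, hc, TensorProduct.tmul_zero, map_zero])
  -- A `k`-linear retraction of `k → L` brings the solution over `L` back to `k`.
  obtain ⟨r, -, hr⟩ := LinearMap.exists_extend_of_notMem (0 : (⊥ : Submodule k L) →ₗ[k] k)
    (v := 1) (by simp) 1
  have hD : ∀ x : L ⊗[k] A, ψ.lTensor A (rightCoaction p (leftSlice r x)) =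
      leftSlice r (D.symm ((ψ.baseChange L).lTensor (L ⊗[k] A)
        (rightCoaction (BialgHom.baseChange L p) x))) := by
    intro x
    induction x with
    | zero => simp
    | add s t hs ht => simp only [map_add, hs, ht]
    | tmul l a =>
      have h := lTensor_baseChange_comul L (ψ ∘ₗ p.toCoalgHom.toLinearMap) l a
      rw [LinearMap.baseChange_comp, LinearMap.lTensor_comp, LinearMap.lTensor_comp] at h
      have h' := (congrArg D.symm h).trans (D.symm_apply_apply _)
      refine Eq.trans ?_ (congrArg (leftSlice r) h'.symm)
      rw [leftSlice_tmul, leftSlice_tmul, map_smul, map_smul]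
      rfl
  refine ⟨leftSlice r x, by rw [hD, hx, map_zero, map_zero], ?_⟩
  have h := leftSlice_lTensor r p.toCoalgHom.toLinearMap x
  rw [← hpL, hpx, leftSlice_tmul, hr, one_smul] at h
  exact h.symm

end BaseChange

/-! ### The h-inverse as a pullback -/

section HInverse

variable {K : Type u} [Field K] {A B : Type v} [Ring A] [Ring B]
    [HopfAlgebra K A] [HopfAlgebra K B] [IsCocomm K A]

theorem HopfSubalgebra.hInverseRestrict_surjective [IsCocomm K B] (p : A →ₐc[K] B)
    (hp : Function.Surjective p) (C : HopfSubalgebra K B) :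
    Function.Surjective (hInverseRestrict p C) := by
  rintro ⟨c, hc⟩
  let ψ := (Subalgebra.toSubmodule C.toSubalgebra).mkQ
  obtain ⟨x, hx, hpx⟩ := exists_lTensor_rightCoaction_eq_zero p hp ψ (c := c) (by
    have hψ : ψ ∘ₗ C.incl = 0 := by
      ext z
      exact (Submodule.Quotient.mk_eq_zero _).2 z.2
    have h := C.map_comul ⟨c, hc⟩
    rw [← h, ← LinearMap.comp_apply, LinearMap.lTensor_comp_map, hψ, TensorProduct.map_zero_right]
    rfl)
  have hxmem : x ∈ hInverseSubalgebra p C := by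
    rw [← Subalgebra.mem_toSubmodule, ← ker_quotientCoaction, LinearMap.mem_ker]
    apply (TensorProduct.comm K _ A).injective
    rw [map_zero, ← hx, ← comm_coaction]
    exact (TensorProduct.map_comm ..).symm
  exact ⟨⟨x, (coe_hInverseSubalgebra p C).le hxmem⟩, Subtype.ext hpx⟩

/-- A morphism of Hopf algebras with values in a Hopf subalgebra, as a morphism to it. -/
noncomputable def HopfSubalgebra.codRestrict {X : Type v} [Ring X] [HopfAlgebra K X]
    (C : HopfSubalgebra K B) (g : X →ₐc[K] B) (hg : ∀ x, g x ∈ C.toSubalgebra) : X →ₐc[K] C :=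
  BialgHom.ofAlgHom ((AlgHomClass.toAlgHom g).codRestrict C.toSubalgebra hg)
    (by ext x; exact CoalgHomClass.counit_comp_apply g x)
    (by
      ext x
      apply C.map_incl_injective
      refine Eq.trans ?_ (C.map_comul _).symm
      refine Eq.trans ?_ (CoalgHomClass.map_comp_comul_apply g x)
      change TensorProduct.map C.incl C.incl (Algebra.TensorProduct.map _ _ (comul (R := K) x)) = _
      generalize comul (R := K) x = t
      induction t with
      | zero => simp
      | add s t hs ht => simp only [map_add, hs, ht]
      | tmul x y => rfl)

/-- The h-inverse contains the image of every morphism `g` whose composite with `p` factors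
through `C`, since `p g(x)₍₁₎ ⊗ g(x)₍₂₎ = f x₍₁₎ ⊗ g x₍₂₎`. -/
theorem HopfSubalgebra.mem_hInverse_of_map_mem {X : Type v} [Ring X] [HopfAlgebra K X]
    (p : A →ₐc[K] B) (C : HopfSubalgebra K B) (f : X →ₐc[K] C) (g : X →ₐc[K] A)
    (h : ∀ x, p (g x) = f x) (x : X) : g x ∈ (hInverse p C).toSubalgebra := by
  refine (coe_hInverseSubalgebra p C).le ((mem_hInverseSubalgebra p C _).2 ?_)
  have h1 : coaction p (g x) = TensorProduct.map C.incl LinearMap.id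
      (TensorProduct.map f.toCoalgHom.toLinearMap g.toCoalgHom.toLinearMap (comul (R := K) x)) := by
    have h2 := (CoalgHomClass.map_comp_comul_apply g x).symm
    rw [coaction_apply, h2]
    generalize comul (R := K) x = t
    induction t with
    | zero => simp
    | add s t hs ht => simp only [map_add, hs, ht]
    | tmul x y => exact congrArg (· ⊗ₜ[K] g y) (h x)
  exact ⟨_, h1.symm⟩

end HInverse

end

theorem mainTheorem4 {K : Type u} [Field K] {A B : Type v} [Ring A] [Ring B]
    [HopfAlgebra K A] [HopfAlgebra K B] [Coalgebra.IsCocomm K A] [Coalgebra.IsCocomm K B]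
    (p : A →ₐc[K] B) (hp : Function.Surjective p) (C : HopfSubalgebra K B) :
    CategoryTheory.IsPullback
      (CocommHopfAlgCat.ofHom (HopfSubalgebra.hInverseRestrict p C))
      (CocommHopfAlgCat.ofHom (HopfSubalgebra.hInverse p C).inclusion)
      (CocommHopfAlgCat.ofHom C.inclusion)
      (CocommHopfAlgCat.ofHom p) ∧
    Function.Surjective (HopfSubalgebra.hInverseRestrict p C) ∧
    ∀ (P : CocommHopfAlgCat.{u, v} K) (q : P ⟶ CocommHopfAlgCat.of K C)
      (j : P ⟶ CocommHopfAlgCat.of K A),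
      CategoryTheory.IsPullback q j (CocommHopfAlgCat.ofHom C.inclusion)
        (CocommHopfAlgCat.ofHom p) →
      Function.Surjective (CocommHopfAlgCat.toBialgHom q) := by
  have happ : ∀ {X Y : CocommHopfAlgCat.{u, v} K} {f g : X ⟶ Y}, f = g → ∀ x,
      CocommHopfAlgCat.toBialgHom f x = CocommHopfAlgCat.toBialgHom g x := by
    rintro X Y f _ rfl x; rfl
  have hext : ∀ {X Y : CocommHopfAlgCat.{u, v} K} {f g : X ⟶ Y},
      (∀ x, CocommHopfAlgCat.toBialgHom f x = CocommHopfAlgCat.toBialgHom g x) → f = g := by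
    intro X Y f g h
    apply CategoryTheory.ObjectProperty.hom_ext
    apply HopfAlgCat.Hom.ext
    exact BialgHom.ext h
  have hpb : CategoryTheory.IsPullback
      (CocommHopfAlgCat.ofHom (HopfSubalgebra.hInverseRestrict p C))
      (CocommHopfAlgCat.ofHom (HopfSubalgebra.hInverse p C).inclusion)
      (CocommHopfAlgCat.ofHom C.inclusion)
      (CocommHopfAlgCat.ofHom p) := by
    refine ⟨⟨hext fun x => rfl⟩, ⟨CategoryTheory.Limits.PullbackCone.IsLimit.mk _
      (fun s => CategoryTheory.ObjectProperty.homMk (HopfAlgCat.ofHom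
        ((HopfSubalgebra.hInverse p C).codRestrict (CocommHopfAlgCat.toBialgHom s.snd)
        (HopfSubalgebra.mem_hInverse_of_map_mem p C (CocommHopfAlgCat.toBialgHom s.fst)
          (CocommHopfAlgCat.toBialgHom s.snd) fun x => (happ s.condition x).symm)))) ?_ ?_ ?_⟩⟩
    · intro s
      exact hext fun x => Subtype.ext (happ s.condition x).symm
    · intro s
      exact hext fun x => rfl
    · intro s m _ hm
      exact hext fun x => Subtype.ext (happ hm x)
  have hsurj := HopfSubalgebra.hInverseRestrict_surjective p hp C
  refine ⟨hpb, hsurj, fun P q j hq c => ?_⟩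
  obtain ⟨x, hx⟩ := hsurj c
  exact ⟨CocommHopfAlgCat.toBialgHom (hq.lift _ _ hpb.w) x,
    (happ (hq.lift_fst _ _ hpb.w) x).trans hx⟩
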